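/- Fix $T>0$. For $\sigma\ge 0$ and $1\le p\le\infty$ let $\mathcal B^p_\sigma$ be the space of entire functions of exponential type $\le\sigma$ whose restriction to $\mathbb R$ is in $L^p(\mathbb R)$, normed by the $L^p(\mathbb R)$-norm. For a tempered distribution $x$ let $\widehat x$ denote its Fourier–Laplace transform, i.e. the entire function whose restriction to $\mathbb R$ represents the Fourier transform of $x$ (normalized by $\widehat\phi(\omega)=\int\phi(t)e^{-i\omega t}\,dt$). Let $\mathcal X^p=\{x\in\mathcal S'(\mathbb R):\widehat x\in\mathcal B^p_{T/2}\}$ with $\|x\|=\|\widehat x\|_{L^p(\mathbb R)}$. A sine-type function of type $\sigma$ is an entire function $S$ of exponential type with simple and separated zeros such that, for some $A,B,H>0$, $Ae^{\sigma|\eta|}\le|S(\xi+i\eta)|\le Be^{\sigma|\eta|}$ for all $\xi\in\mathbb R$ and $|\eta|\ge H$. Condition A for vectors $\alpha^{(m)}=(\alpha^{(m)}_1,\dots,\alpha^{(m)}_K)\in\mathbb C^K$, $m=1,\dots,K^2$: they form a 2-uniform $K^2/K$-tight frame, that is, all $\|\alpha^{(m)}\|$ are equal, all $|\langle\alpha^{(m)},\alpha^{(l)}\rangle|$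 with $m\ne l$ are equal, and $\sum_m|\langle v,\alpha^{(m)}\rangle|^2=\frac{K^2}{K}\|v\|^2$ for all $v\in\mathbb C^K$. Condition B, with period $\beta>0$, for distinct points $\lambda_1,\dots,\lambda_K\in\mathbb C$ ordered by increasing real part: for some $1\le a<K$ one has $n\beta+\lambda_i=(n-1)\beta+\lambda_{K-a+i}$ for all $n\in\mathbb Z$, $i=1,\dots,a$, and the set $\Lambda=\bigcup_{n\in\mathbb Z}\{n\beta+\lambda_k\}_{k=1}^K$ is, if $1<p<\infty$, complete interpolating for $\mathcal B^p_{T/2}$ (for every $c\in\ell^p(\Lambda)$ there is exactly one $f\in\mathcal B^p_{T/2}$ with $f|_\Lambda=c$), and, if $p=1$ or $p=\infty$, the zero set of a sine-type function of type $\widetilde T/2$ for some $\widetilde T>T$. **Corollary.** For every $1\le p\le\infty$ and every $\varepsilon>0$ there are a tempered distribution $u$ whose Fourier–Laplace transform $\widehat u$ is a sine-type function of type $T'/2$ for some $T'>T$, a number $K$, coefficients $\{\alpha^{(m)}_k:k=1,\dots,K,\ m=1,\dots,K^2\}$ satisfying Condition A, and points $\{\lambda_k\}_{k=1}^K$ satisfying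 Condition B with some period $\beta>0$, such that every $x\in\mathcal X^p$ with $\|x\|\le1$ is determined, up to a constant unimodular factor, among all such $x$ by the intensity samples $$c^{(m)}_n=\Bigl|\sum_{k=1}^K\alpha^{(m)}_k\,\widehat{(x+u)}(n\beta+\lambda_k)\Bigr|^2,\qquad n\in\mathbb Z,\ m=1,\dots,K^2,$$ and such that the sampling rate $K^2/\beta$ satisfies $\bigl|K^2/\beta-4R_{\mathrm{Ny}}\bigr|<\varepsilon$, where $R_{\mathrm{Ny}}=T/(2\pi)$ is the Nyquist rate. -/

import Mathlib

open MeasureTheory Filter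
open scoped ENNReal SchwartzMap FourierTransform

noncomputable section

namespace PhaseRetrieval

/-! ### Entire functions of exponential type, Bernstein spaces, sine-type functions -/

/-- `f` has exponential type at most `σ`. -/
def HasExpType (σ : ℝ) (f : ℂ → ℂ) : Prop :=
  ∀ ε > 0, ∃ C : ℝ, ∀ z : ℂ, ‖f z‖ ≤ C * Real.exp ((σ + ε) * ‖z‖)

/-- The Bernstein space `𝓑^p_σ`: entire functions of exponential type at most `σ` whose
restriction to the real line lies in `L^p(ℝ)`. -/
def bernsteinSpace (σ : ℝ) (p : ℝ≥0∞) : Set (ℂ → ℂ) :=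
  {f | Differentiable ℂ f ∧ HasExpType σ f ∧ MemLp (fun t : ℝ => f t) p volume}

/-- Sine-type functions of type `σ`: entire functions of exponential type with simple and
separated zeros and two-sided exponential bounds off a horizontal strip. -/
structure IsSineType (σ : ℝ) (S : ℂ → ℂ) : Prop where
  entire : Differentiable ℂ S
  expType : ∃ τ : ℝ, HasExpType τ S
  simple_zeros : ∀ z, S z = 0 → deriv S z ≠ 0
  separated_zeros : ∃ δ > 0, ∀ z w, S z = 0 → S w = 0 → z ≠ w → δ ≤ dist z w
  bounds : ∃ A B H : ℝ, 0 < A ∧ 0 < B ∧ 0 < H ∧ ∀ z : ℂ, H ≤ |z.im| →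
    A * Real.exp (σ * |z.im|) ≤ ‖S z‖ ∧ ‖S z‖ ≤ B * Real.exp (σ * |z.im|)

/-- A set `Λ` of complex points is complete interpolating for `𝓑^p_σ`: every `ℓ^p` family of
values on `Λ` is attained by exactly one element of `𝓑^p_σ`. -/
def IsCompleteInterpolating (σ : ℝ) (p : ℝ≥0∞) (Λ : Set ℂ) : Prop :=
  ∀ c : Λ → ℂ, Memℓp c p → ∃! f : ℂ → ℂ, f ∈ bernsteinSpace σ p ∧ ∀ z : Λ, f z = c z

/-! ### Fourier–Laplace transform of tempered distributions -/

/-- The Fourier transform on Schwartz functions in the normalization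
`φ̂(ω) = ∫ φ(t) exp(-iωt) dt`, see `angularFourier_apply`. -/
def angularFourier (φ : 𝓢(ℝ, ℂ)) : 𝓢(ℝ, ℂ) :=
  SchwartzMap.compCLMOfContinuousLinearEquiv ℂ
    (ContinuousLinearEquiv.unitsEquivAut ℝ
      (Units.mk0 ((2 * Real.pi)⁻¹ : ℝ) (inv_ne_zero Real.two_pi_pos.ne'))) (𝓕 φ)

theorem angularFourier_apply (φ : 𝓢(ℝ, ℂ)) (ω : ℝ) :
    angularFourier φ ω = ∫ t : ℝ, φ t * Complex.exp (-(Complex.I * ω * t)) := by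
  have h : angularFourier φ ω = (𝓕 (φ : ℝ → ℂ)) (ω * (2 * Real.pi)⁻¹) := by
    simp [angularFourier, SchwartzMap.fourier_coe]
  rw [h, Real.fourier_real_eq_integral_exp_smul]
  refine integral_congr_ae (Eventually.of_forall fun t => ?_)
  have hpi : (Real.pi : ℂ) ≠ 0 := by exact_mod_cast Real.pi_ne_zero
  simp only [smul_eq_mul]
  rw [mul_comm]
  congr 2
  push_cast
  field_simp

/-- The entire function `f` is the Fourier–Laplace transform of the tempered distribution `x`:
its restriction to `ℝ` represents the Fourier transform `x̂(φ) = x(φ̂)`. Such an `f` is unique. -/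
def IsFourierLaplace (x : 𝓢'(ℝ, ℂ)) (f : ℂ → ℂ) : Prop :=
  Differentiable ℂ f ∧ ∀ φ : 𝓢(ℝ, ℂ),
    Integrable (fun ω : ℝ => f ω * φ ω) ∧ x (angularFourier φ) = ∫ ω : ℝ, f ω * φ ω

open Classical in
/-- The Fourier–Laplace transform `x̂ : ℂ → ℂ` (the zero function if `x` has none). -/
def fourierLaplace (x : 𝓢'(ℝ, ℂ)) : ℂ → ℂ :=
  if h : ∃ f, IsFourierLaplace x f then h.choose else 0

/-- The signal space `𝓧^p` of tempered distributions whose Fourier–Laplace transform belongs to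
the Bernstein space `𝓑^p_{T/2}`. -/
def signalSpace (T : ℝ) (p : ℝ≥0∞) : Set 𝓢'(ℝ, ℂ) :=
  {x | ∃ f ∈ bernsteinSpace (T / 2) p, IsFourierLaplace x f}

/-- The norm of a signal: the `L^p(ℝ)` norm of its Fourier transform. -/
def signalNorm (p : ℝ≥0∞) (x : 𝓢'(ℝ, ℂ)) : ℝ≥0∞ :=
  eLpNorm (fun ω : ℝ => fourierLaplace x ω) p volume

/-! ### The conditions on the measurement system -/

/-- A finite family of vectors in `ℂ^K` is a 2-uniform `A`-tight frame: all vectors have the same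
norm, all pairs of different vectors have inner products of the same modulus, and the frame
identity with constant `A` holds. -/
def IsTwoUniformTightFrame {K M : ℕ} (A : ℝ) (α : Fin M → EuclideanSpace ℂ (Fin K)) : Prop :=
  (∃ b : ℝ, ∀ m, ‖α m‖ = b) ∧
  (∃ c : ℝ, ∀ i j, i ≠ j → ‖inner ℂ (α i) (α j)‖ = c) ∧
  ∀ v : EuclideanSpace ℂ (Fin K), ∑ m, ‖inner ℂ (α m) v‖ ^ 2 = A * ‖v‖ ^ 2

/-- Condition A: the `M = K²` coefficient vectors form a 2-uniform `M/K`-tight frame. -/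
def ConditionA {K : ℕ} (α : Fin (K ^ 2) → EuclideanSpace ℂ (Fin K)) : Prop :=
  IsTwoUniformTightFrame (((K ^ 2 : ℕ) : ℝ) / (K : ℝ)) α

/-- The interpolation points `λ_{n,k} = nβ + λ_k`. -/
def samplePoint {K : ℕ} (β : ℝ) (lam : Fin K → ℂ) (n : ℤ) (k : Fin K) : ℂ :=
  (n : ℂ) * (β : ℂ) + lam k

/-- The overall interpolation set `Λ = ⋃ₙ {nβ + λ_k}`. -/
def interpolationSet {K : ℕ} (β : ℝ) (lam : Fin K → ℂ) : Set ℂ :=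
  {z | ∃ (n : ℤ) (k : Fin K), z = samplePoint β lam n k}

/-- Condition B with sampling period `β`. The points are distinct and ordered by real part; for
some overlap `1 ≤ a < K` the first `a` points of each block are the last `a` points of the
previous block; and the overall set `Λ` is an interpolation set for the Bernstein space: complete
interpolating for `𝓑^p_{T/2}` if `1 < p < ∞`, and the zero set of a sine-type function of type
`T₁/2` with `T₁ > T` in the endpoint cases `p = 1` and `p = ∞`. -/
structure ConditionB {K : ℕ} (T : ℝ) (p : ℝ≥0∞) (β : ℝ) (lam : Fin K → ℂ) : Prop where
  period_pos : 0 < β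
  distinct : Function.Injective lam
  ordered : Monotone fun k => (lam k).re
  overlap : ∃ a : ℕ, 1 ≤ a ∧ a < K ∧ ∀ (n : ℤ) (i j : Fin K),
    (i : ℕ) < a → (j : ℕ) + a = K + i → samplePoint β lam n i = samplePoint β lam (n - 1) j
  interpolating : 1 < p → p < ∞ →
    IsCompleteInterpolating (T / 2) p (interpolationSet β lam)
  endpoint : p = 1 ∨ p = ∞ →
    ∃ T₁ > T, ∃ S : ℂ → ℂ, IsSineType (T₁ / 2) S ∧ interpolationSet β lam = {z | S z = 0}

/-- The intensity samples `c_n^{(m)} = |∑_k α_k^{(m)} (x+u)^(nβ + λ_k)|²`. -/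
def intensity {K : ℕ} (u : 𝓢'(ℝ, ℂ)) (α : Fin (K ^ 2) → EuclideanSpace ℂ (Fin K)) (β : ℝ)
    (lam : Fin K → ℂ) (x : 𝓢'(ℝ, ℂ)) (n : ℤ) (m : Fin (K ^ 2)) : ℝ :=
  ‖∑ k, α m k * fourierLaplace (x + u) (samplePoint β lam n k)‖ ^ 2

/-- The Nyquist rate `T / (2π)` of signals supported in `[-T/2, T/2]`. -/
def nyquistRate (T : ℝ) : ℝ := T / (2 * Real.pi)

/-- The sampling rate `M / β` of `M = K²` branches sampled with period `β`. -/
def samplingRate (K : ℕ) (β : ℝ) : ℝ := ((K ^ 2 : ℕ) : ℝ) / β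

end PhaseRetrieval

end

/-!
Take `K = 2` and the points `0`, `β` in each block, so that consecutive blocks share one point,
`Λ = βℤ`, and four vectors sample at rate `4 / β`. The tetrahedral frame
(`tetrahedralFrame`) satisfies Condition A, and its four intensities of a pair `(a, b)` determine
`|a|` and `b ā` (`eq_of_intensities`). Because of the overlap of consecutive blocks, the samples of
`x̂ + û` at `βℤ` are known up to one common phase `γ` as soon as none of them vanishes
(`exists_common_phase`). This is ensured by a reference `û = A sin (τ (z - i))`, the transform of
two point masses: its zeros lie off `ℝ`, so for large `A` it dominates on `ℝ` every function in the
unit ball of the Bernstein space, which is uniformly bounded there (`norm_le_of_mem_bernsteinSpace`).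

If `x` and `y` have the same intensities, then `x̂ - γ ŷ = (γ - 1) û` on `βℤ`, and it remains to see
that `γ = 1` and that a function in the Bernstein space is determined by its values on `βℤ`.

* For `1 < p < ∞` the period is critical, `β = 2π / T`. A function in the Bernstein space cannot have
  samples bounded away from zero (`not_samples_bounded_below`), whereas those of `û` are; so `γ = 1`.
* For `p = 1` and `p = ∞` the period `2π / (T + ε)` is slightly smaller and the type `τ` of `û` lies
  strictly between `T / 2` and `(T + ε) / 2`. Then `x̂ - γ ŷ - (γ - 1) û` vanishes identically, and
  `û` outgrows `x̂ - γ ŷ` along the imaginary axis unless `γ = 1`.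

Both cases rest on the fact that an entire function that is `O(exp (π |Im z|))` and vanishes on `ℤ`
is a multiple of `sin πz` (`eq_const_mul_sin_of_forall_int`).

The substantial part is that `βℤ` is complete interpolating at the critical rate for `1 < p < ∞`,
i.e. that cardinal series with `ℓ^p` coefficients converge in `L^p`. This is equivalent to the
theorem of M. Riesz on the discrete Hilbert transform. It is proved for the Cauchy transform
`F(z) = ∑ d_n / (z - n)` on the line `Im z = 1` (`rieszBound`). For `1 < p ≤ 2` and `d ≥ 0`, the
function `(iF)^p` is holomorphic in the upper half-plane and integrates to zero along that line,
while `|w|^p ≤ a (Re w)^p - b Re (w^p)` for `Re w ≥ 0`; thus the `L^p` norm of `F` is controlled by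
that of `Re (iF)`, a Poisson sum, to which Young's inequality applies. Duality gives `p > 2`. The
passage between `ℤ + i`, the line `Im z = 1` and the real line costs only convolutions with the
summable kernel `1 / (k² + 1)`.
-/


noncomputable section

namespace PhaseRetrieval

/-! ### Growth of functions of exponential type -/

/-- Phragmén–Lindelöf in the right half-plane for `f(iw) exp (-(σ + ε) w)`, and `ε → 0`. -/
theorem norm_le_of_expType_upper {f : ℂ → ℂ} {σ M : ℝ} (hd : Differentiable ℂ f)
    (he : HasExpType σ f) (hM : ∀ x : ℝ, ‖f x‖ ≤ M) {z : ℂ} (hz : 0 ≤ z.im) :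
    ‖f z‖ ≤ M * Real.exp (σ * z.im) := by
  have key : ∀ ε > 0, ‖f z‖ ≤ M * Real.exp ((σ + ε) * z.im) := by
    intro ε hε
    obtain ⟨C, hC⟩ := he ε hε
    set g : ℂ → ℂ := fun w => f (Complex.I * w) * Complex.exp (-((σ + ε : ℝ) * w)) with hg
    have hgn : ∀ w, ‖g w‖ = ‖f (Complex.I * w)‖ * Real.exp (-((σ + ε) * w.re)) := by
      intro w
      simp only [hg, norm_mul, Complex.norm_exp, Complex.neg_re, Complex.re_ofReal_mul]
    have hbound := PhragmenLindelof.right_half_plane_of_bounded_on_real (f := g) (C := M)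
      (z := -Complex.I * z) ?_ ?_ ?_ ?_ ?_
    · rw [hgn] at hbound
      have h1 : Complex.I * (-Complex.I * z) = z := by
        rw [← mul_assoc]; simp
      have h2 : (-Complex.I * z).re = z.im := by simp
      rw [h1, h2, Real.exp_neg, ← div_eq_mul_inv, div_le_iff₀ (Real.exp_pos _)] at hbound
      exact hbound
    · apply Differentiable.diffContOnCl
      have : Differentiable ℂ fun w => f (Complex.I * w) := hd.comp (by fun_prop)
      fun_prop
    · refine ⟨1, one_lt_two, 2 * |σ + ε|, ?_⟩
      refine Asymptotics.IsBigO.of_bound C (Eventually.of_forall fun w => ?_)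
      have hCw := hC (Complex.I * w)
      rw [norm_mul, Complex.norm_I, one_mul] at hCw
      rw [hgn, Real.norm_of_nonneg (Real.exp_pos _).le, Real.rpow_one]
      have hC0 : 0 ≤ C * Real.exp ((σ + ε) * ‖w‖) := (norm_nonneg _).trans hCw
      have hC0' : 0 ≤ C := nonneg_of_mul_nonneg_left hC0 (Real.exp_pos _)
      calc _ ≤ C * Real.exp ((σ + ε) * ‖w‖) * Real.exp (-((σ + ε) * w.re)) := by gcongr
        _ = C * Real.exp ((σ + ε) * ‖w‖ + -((σ + ε) * w.re)) := by rw [Real.exp_add]; ring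
        _ ≤ _ := by
          gcongr
          have h1 := le_abs_self (σ + ε)
          have h2 := neg_abs_le (σ + ε)
          have h3 := Complex.abs_re_le_norm w
          have h4 : -((σ + ε) * w.re) ≤ |σ + ε| * ‖w‖ := by
            refine (neg_le_abs _).trans ?_
            rw [abs_mul]; gcongr
          nlinarith [norm_nonneg w]
    · refine isBoundedUnder_of_eventually_le (a := C) ?_
      filter_upwards [eventually_ge_atTop 0] with x hx
      have hCw := hC (Complex.I * x)
      rw [norm_mul, Complex.norm_I, one_mul, Complex.norm_real, Real.norm_of_nonneg hx] at hCw
      rw [hgn, Complex.ofReal_re, Real.exp_neg, ← div_eq_mul_inv, div_le_iff₀ (Real.exp_pos _)]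
      exact hCw
    · intro x
      rw [hgn]
      have h1 : Complex.I * (x * Complex.I) = ((-x : ℝ) : ℂ) := by
        rw [mul_comm, mul_assoc, Complex.I_mul_I]; simp
      rw [h1]
      simpa using hM (-x)
    · simpa using hz
  refine ge_of_tendsto (f := fun ε : ℝ => M * Real.exp ((σ + ε) * z.im))
    (x := nhdsWithin 0 (Set.Ioi 0)) ?_
    (by filter_upwards [self_mem_nhdsWithin] with ε hε using key ε hε)
  refine Tendsto.mono_left ?_ nhdsWithin_le_nhds
  exact Continuous.tendsto' (by fun_prop) _ _ (by simp)

theorem HasExpType.comp_neg {f : ℂ → ℂ} {σ : ℝ} (he : HasExpType σ f) :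
    HasExpType σ fun z => f (-z) := fun ε hε => by
  obtain ⟨C, hC⟩ := he ε hε
  exact ⟨C, fun z => by simpa using hC (-z)⟩

/-- A function of exponential type `σ` that is bounded on the real line grows only with the
imaginary part; this is the Phragmén–Lindelöf principle in the two half-planes. -/
theorem norm_le_of_expType {f : ℂ → ℂ} {σ M : ℝ} (hd : Differentiable ℂ f)
    (he : HasExpType σ f) (hM : ∀ x : ℝ, ‖f x‖ ≤ M) (z : ℂ) :
    ‖f z‖ ≤ M * Real.exp (σ * |z.im|) := by
  rcases le_total 0 z.im with h | h
  · rw [abs_of_nonneg h]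
    exact norm_le_of_expType_upper hd he hM h
  · rw [abs_of_nonpos h]
    have := norm_le_of_expType_upper (f := fun z => f (-z)) (hd.comp differentiable_neg)
      he.comp_neg (M := M) (fun x => by simpa using hM (-x)) (z := -z) (by simpa using h)
    simpa using this

theorem hasExpType_of_norm_le {f : ℂ → ℂ} {σ M : ℝ} (hσ : 0 ≤ σ)
    (h : ∀ z, ‖f z‖ ≤ M * Real.exp (σ * |z.im|)) : HasExpType σ f := by
  have hM : 0 ≤ M := by
    have := (norm_nonneg _).trans (h 0)
    simpa using this
  intro ε hε
  refine ⟨M, fun z => (h z).trans ?_⟩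
  gcongr
  · linarith
  · exact Complex.abs_im_le_norm z

theorem HasExpType.add {f g : ℂ → ℂ} {σ : ℝ} (hf : HasExpType σ f) (hg : HasExpType σ g) :
    HasExpType σ (f + g) := fun ε hε => by
  obtain ⟨C, hC⟩ := hf ε hε
  obtain ⟨D, hD⟩ := hg ε hε
  refine ⟨C + D, fun z => ?_⟩
  rw [add_mul]
  exact (norm_add_le _ _).trans (add_le_add (hC z) (hD z))

theorem HasExpType.const_mul {f : ℂ → ℂ} {σ : ℝ} (hf : HasExpType σ f) (c : ℂ) :
    HasExpType σ (fun z => c * f z) := fun ε hε => by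
  obtain ⟨C, hC⟩ := hf ε hε
  refine ⟨‖c‖ * C, fun z => ?_⟩
  rw [norm_mul, mul_assoc]
  exact mul_le_mul_of_nonneg_left (hC z) (norm_nonneg _)

/-- Over an interval of length at most one, the integral is dominated by the `L^p` norm. -/
theorem norm_integral_le_eLpNorm {h : ℝ → ℂ} {p : ℝ≥0∞} (hp : 1 ≤ p) (hh : MemLp h p volume)
    {a b : ℝ} (hab : a ≤ b) (hb : b ≤ a + 1) :
    ‖∫ s in a..b, h s‖ ≤ (eLpNorm h p volume).toReal := by
  rw [intervalIntegral.integral_of_le hab]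
  rw [← toReal_enorm]
  refine ENNReal.toReal_mono hh.eLpNorm_ne_top ?_
  calc ‖∫ s in Set.Ioc a b, h s‖ₑ ≤ ∫⁻ s in Set.Ioc a b, ‖h s‖ₑ :=
        enorm_integral_le_lintegral_enorm _
    _ = eLpNorm h 1 (volume.restrict (Set.Ioc a b)) := by rw [eLpNorm_one_eq_lintegral_enorm]
    _ ≤ eLpNorm h p (volume.restrict (Set.Ioc a b)) *
        (volume.restrict (Set.Ioc a b)) Set.univ ^ (1 / (1 : ℝ≥0∞).toReal - 1 / p.toReal) :=
      eLpNorm_le_eLpNorm_mul_rpow_measure_univ hp hh.1.restrict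
    _ ≤ eLpNorm h p volume * 1 := by
      gcongr
      · exact Measure.restrict_le_self
      · refine ENNReal.rpow_le_one ?_ ?_
        · simp only [Measure.restrict_apply_univ, Real.volume_Ioc]
          exact ENNReal.ofReal_le_one.2 (by linarith)
        · rcases eq_or_ne p ∞ with rfl | hp'
          · simp
          · have : 1 ≤ p.toReal := by
              simpa using ENNReal.toReal_mono hp' hp
            simp only [ENNReal.toReal_one, sub_nonneg]
            rw [div_le_div_iff₀ (by linarith) one_pos]
            linarith
    _ = _ := mul_one _

/-- The translation difference `∫₀ᵗ f(z+s) ds` of a primitive of `f` is of exponential type and is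
bounded on the real line by the `L^p` norm of `f`, so its derivative `f(x+t) - f(x)` is bounded
there as well. -/
theorem norm_translate_sub_le {f : ℂ → ℂ} {σ : ℝ} (hσ : 0 ≤ σ) {p : ℝ≥0∞} (hp : 1 ≤ p)
    (hf : f ∈ bernsteinSpace σ p) {t : ℝ} (ht0 : 0 ≤ t) (ht1 : t ≤ 1) (x : ℝ) :
    ‖f (x + t : ℝ) - f x‖ ≤ Real.exp σ * (eLpNorm (fun s : ℝ => f s) p volume).toReal := by
  obtain ⟨hd, he, hL⟩ := hf
  obtain ⟨F, hF⟩ := hd.isExactOn_univ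
  replace hF : ∀ z, HasDerivAt F (f z) z := fun z => hF z trivial
  set N := (eLpNorm (fun s : ℝ => f s) p volume).toReal
  set g : ℂ → ℂ := fun z => F (z + t) - F z with hg
  have hFd : Differentiable ℂ F := fun z => (hF z).differentiableAt
  have hgd : ∀ z, HasDerivAt g (f (z + t) - f z) z := fun z =>
    ((hF (z + t)).comp_add_const z t).sub (hF z)
  have hgi : ∀ z, g z = ∫ s in (0 : ℝ)..t, f (z + s) := by
    intro z
    have h1 : ∀ s ∈ Set.uIcc 0 t, HasDerivAt (fun s : ℝ => F (z + s)) (f (z + s)) s := by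
      intro s _
      have := (hF (z + s)).scomp s ((Complex.ofRealCLM.hasDerivAt (x := s)).const_add z)
      simpa using! this
    rw [intervalIntegral.integral_eq_sub_of_hasDerivAt h1]
    · simp [hg]
    · apply Continuous.intervalIntegrable
      have := hd.continuous
      fun_prop
  have hgreal : ∀ x : ℝ, ‖g x‖ ≤ N := by
    intro x
    rw [hgi]
    have : (∫ s in (0 : ℝ)..t, f (x + s)) = ∫ s in x..(x + t), f s := by
      have := intervalIntegral.integral_comp_add_left (a := 0) (b := t) (fun s : ℝ => f s) x
      simpa using this
    rw [this]
    exact norm_integral_le_eLpNorm hp hL (by linarith) (by linarith)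
  have hge : HasExpType σ g := by
    intro ε hε
    obtain ⟨C, hC⟩ := he ε hε
    have hC0 : 0 ≤ C := by simpa using (norm_nonneg _).trans (hC 0)
    refine ⟨C * Real.exp (σ + ε), fun z => ?_⟩
    rw [hgi]
    refine (intervalIntegral.norm_integral_le_of_norm_le_const
      (C := C * Real.exp (σ + ε) * Real.exp ((σ + ε) * ‖z‖)) ?_).trans ?_
    · intro s hs
      rw [Set.uIoc_of_le ht0] at hs
      refine (hC _).trans ?_
      rw [mul_assoc, ← Real.exp_add]
      gcongr
      have : ‖z + s‖ ≤ ‖z‖ + 1 := by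
        refine (norm_add_le _ _).trans ?_
        gcongr
        rw [Complex.norm_real, Real.norm_of_nonneg hs.1.le]
        linarith [hs.2]
      nlinarith
    · rw [sub_zero, abs_of_nonneg ht0]
      exact mul_le_of_le_one_right (by positivity) ht1
  have hgb := norm_le_of_expType (fun z => (hgd z).differentiableAt) hge hgreal
  have hder := Complex.norm_deriv_le_of_forall_mem_sphere_norm_le (c := (x : ℂ)) (R := 1)
    (C := N * Real.exp σ) (f := g) one_pos
    (Differentiable.diffContOnCl fun z => (hgd z).differentiableAt) ?_
  · rw [(hgd x).deriv] at hder
    push_cast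
    linarith
  · intro z hz
    refine (hgb z).trans ?_
    have : |z.im| ≤ 1 := by
      have h1 := Complex.abs_im_le_norm (z - x)
      rw [mem_sphere_iff_norm.1 hz] at h1
      simpa using h1
    have hN : 0 ≤ N := ENNReal.toReal_nonneg
    gcongr
    nlinarith

/-- Functions in a Bernstein space are bounded on the real line by a multiple of their norm, and
hence grow only with the imaginary part. -/
theorem norm_le_of_mem_bernsteinSpace {f : ℂ → ℂ} {σ : ℝ} (hσ : 0 ≤ σ) {p : ℝ≥0∞} (hp : 1 ≤ p)
    (hf : f ∈ bernsteinSpace σ p) (z : ℂ) :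
    ‖f z‖ ≤ (1 + Real.exp σ) * (eLpNorm (fun s : ℝ => f s) p volume).toReal *
      Real.exp (σ * |z.im|) := by
  refine norm_le_of_expType hf.1 hf.2.1 (fun x => ?_) z
  set N := (eLpNorm (fun s : ℝ => f s) p volume).toReal with hN
  have hc : Continuous fun s : ℝ => f s := hf.1.continuous.comp Complex.continuous_ofReal
  have hc' : Continuous fun t : ℝ => f (x + t : ℝ) := hc.comp (by fun_prop)
  have h1 : ‖∫ t in (0 : ℝ)..1, f (x + t : ℝ)‖ ≤ N := by
    have h := intervalIntegral.integral_comp_add_left (a := 0) (b := 1) (fun s : ℝ => f s) x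
    rw [h]
    exact norm_integral_le_eLpNorm hp hf.2.2 (by linarith) (by linarith)
  have h2 : ‖∫ t in (0 : ℝ)..1, (f (x + t : ℝ) - f x)‖ ≤ Real.exp σ * N := by
    have := intervalIntegral.norm_integral_le_of_norm_le_const (a := 0) (b := 1)
      (f := fun t : ℝ => f (x + t : ℝ) - f x) (C := Real.exp σ * N) ?_
    · simpa using this
    · intro t ht
      rw [Set.uIoc_of_le zero_le_one] at ht
      exact norm_translate_sub_le hσ hp hf ht.1.le ht.2 x
  have h3 : f x =
      (∫ t in (0 : ℝ)..1, f (x + t : ℝ)) - ∫ t in (0 : ℝ)..1, (f (x + t : ℝ) - f x) := by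
    rw [intervalIntegral.integral_sub (hc'.intervalIntegrable _ _) (by simp)]
    simp
  calc ‖f x‖ ≤ N + Real.exp σ * N := by
        rw [h3]; exact (norm_sub_le _ _).trans (add_le_add h1 h2)
    _ = _ := by ring

theorem norm_deriv_le_of_expType {f : ℂ → ℂ} {σ M : ℝ} (hσ : 0 ≤ σ) (hd : Differentiable ℂ f)
    (h : ∀ z, ‖f z‖ ≤ M * Real.exp (σ * |z.im|)) (x : ℝ) :
    ‖deriv f x‖ ≤ M * Real.exp σ := by
  have hM : 0 ≤ M := by simpa using (norm_nonneg _).trans (h 0)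
  have hder := Complex.norm_deriv_le_of_forall_mem_sphere_norm_le (c := (x : ℂ)) (R := 1)
    (C := M * Real.exp σ) (f := f) one_pos hd.diffContOnCl ?_
  · simpa using hder
  · intro z hz
    refine (h z).trans ?_
    have : |z.im| ≤ 1 := by
      have h1 := Complex.abs_im_le_norm (z - x)
      rw [mem_sphere_iff_norm.1 hz] at h1
      simpa using h1
    gcongr
    nlinarith

/-- For `p < ∞` the samples of a Bernstein function at `a + nβ` cannot stay away from zero: the
function is Lipschitz on `ℝ`, so it would be large on infinitely many intervals of a fixed
length. -/
theorem not_samples_bounded_below {f : ℂ → ℂ} {σ : ℝ} (hσ : 0 ≤ σ) {p : ℝ≥0∞} (hp : 1 ≤ p)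
    (hp' : p ≠ ∞) (hf : f ∈ bernsteinSpace σ p) {β : ℝ} (hβ : 0 < β) {c : ℝ} (hc : 0 < c)
    (a : ℝ) (h : ∀ n : ℤ, c ≤ ‖f (a + n * β)‖) : False := by
  obtain ⟨L, hL0, hL⟩ : ∃ L : ℝ, 0 < L ∧ ∀ x : ℝ, ‖deriv f x‖ ≤ L := by
    refine ⟨_, ?_, fun x => (norm_deriv_le_of_expType hσ hf.1
      (norm_le_of_mem_bernsteinSpace hσ hp hf) x).trans (le_add_of_nonneg_right zero_le_one)⟩
    positivity
  have hlip : ∀ x y : ℝ, ‖f y - f x‖ ≤ L * |y - x| := by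
    intro x y
    have := Convex.norm_image_sub_le_of_norm_hasDerivWithin_le (f := fun t : ℝ => f t)
      (f' := fun t : ℝ => deriv f t) (s := Set.univ) (C := L) (x := x) (y := y)
      (fun t _ => (hf.1 t).hasDerivAt.comp_ofReal.hasDerivWithinAt) (fun t _ => hL t) convex_univ
      trivial trivial
    simpa using this
  set δ := min β (c / (2 * L)) with hδ
  have hδ0 : 0 < δ := lt_min hβ (by positivity)
  have hfin := hf.2.2.meas_ge_lt_top_enorm (by positivity) hp' (ε := (c / 2).toNNReal)
    (by simpa using hc)
  have hsub : (⋃ n : ℤ, Set.Ioo (a + n * β) (a + n * β + δ)) ⊆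
      {x : ℝ | ((c / 2).toNNReal : ℝ≥0∞) ≤ ‖f x‖ₑ} := by
    intro x hx
    obtain ⟨n, hn⟩ := Set.mem_iUnion.1 hx
    have h1 := hlip x (a + n * β)
    have h2 : L * |a + n * β - x| ≤ c / 2 := by
      have : |a + n * β - x| ≤ c / (2 * L) := by
        rw [abs_sub_comm, abs_of_nonneg (by linarith [hn.1])]
        exact le_trans (sub_left_le_of_le_add hn.2.le) (min_le_right _ _)
      calc _ ≤ L * (c / (2 * L)) := by gcongr
        _ = _ := by field_simp
    have h3 := h n
    push_cast at h1
    have h4 := norm_sub_norm_le (f (a + n * β)) (f x)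
    change ((c / 2).toNNReal : ℝ≥0∞) ≤ ‖f x‖ₑ
    rw [← ofReal_norm]
    exact ENNReal.ofReal_le_ofReal (by linarith)
  refine (measure_mono hsub).not_gt (lt_of_lt_of_le hfin ?_)
  rw [measure_iUnion _ fun n => measurableSet_Ioo]
  · have : ∀ n : ℤ, volume (Set.Ioo (a + n * β) (a + n * β + δ)) = ENNReal.ofReal δ := by
      intro n; simp
    simp only [this]
    rw [ENNReal.tsum_const_eq_top_of_ne_zero (by simpa using hδ0)]
  · intro m n hmn
    refine Set.disjoint_left.2 fun x hm hn => hmn ?_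
    have hδβ : δ ≤ β := min_le_left _ _
    have h1 : (m : ℝ) * β < (n + 1) * β := by linarith [hm.1, hn.2]
    have h2 : (n : ℝ) * β < (m + 1) * β := by linarith [hn.1, hm.2]
    have h1' := lt_of_mul_lt_mul_right h1 hβ.le
    have h2' := lt_of_mul_lt_mul_right h2 hβ.le
    norm_cast at h1' h2'
    omega

/-! ### Functions vanishing on the integers -/

theorem norm_sin_sq (z : ℂ) :
    ‖Complex.sin z‖ ^ 2 = Real.sin z.re ^ 2 + Real.sinh z.im ^ 2 := by
  rw [Complex.sq_norm, Complex.sin_eq, Complex.normSq_apply]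
  simp only [← Complex.ofReal_sin, ← Complex.ofReal_cos, ← Complex.ofReal_sinh,
    ← Complex.ofReal_cosh, Complex.add_re, Complex.add_im, Complex.mul_re, Complex.mul_im,
    Complex.ofReal_re, Complex.ofReal_im, Complex.I_re, Complex.I_im]
  have h1 := Real.sin_sq_add_cos_sq z.re
  have h2 := Real.cosh_sq z.im
  linear_combination Real.sin z.re ^ 2 * h2 + Real.sinh z.im ^ 2 * h1

theorem sinh_abs_le_norm_sin (z : ℂ) : Real.sinh |z.im| ≤ ‖Complex.sin z‖ := by
  refine le_of_abs_le (abs_le_of_sq_le_sq ?_ (norm_nonneg _))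
  have h1 : Real.sinh |z.im| ^ 2 = Real.sinh z.im ^ 2 := by
    rcases abs_choice z.im with h | h <;> rw [h]
    rw [Real.sinh_neg, neg_sq]
  rw [h1, norm_sin_sq]
  nlinarith [sq_nonneg (Real.sin z.re)]

theorem norm_sin_le_exp (z : ℂ) : ‖Complex.sin z‖ ≤ Real.exp |z.im| := by
  refine le_of_abs_le (abs_le_of_sq_le_sq ?_ (Real.exp_pos _).le)
  have h1 : Real.cosh z.im ≤ Real.exp |z.im| := by
    rw [← Real.cosh_abs, Real.cosh_eq]
    have : Real.exp (-|z.im|) ≤ Real.exp |z.im| := Real.exp_le_exp.2 (by linarith [abs_nonneg z.im])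
    linarith
  have h2 : Real.cosh z.im ^ 2 ≤ Real.exp |z.im| ^ 2 := by
    gcongr
  rw [norm_sin_sq]
  have h3 := Real.cosh_sq z.im
  have h4 := Real.sin_sq_le_one z.re
  linarith

theorem exp_div_four_le_sinh {x : ℝ} (hx : 1 ≤ x) : Real.exp x / 4 ≤ Real.sinh x := by
  rw [Real.sinh_eq]
  have h1 : Real.exp (-x) ≤ 1 := Real.exp_le_one_iff.2 (by linarith)
  have h2 : 2 ≤ Real.exp x := by linarith [Real.add_one_le_exp x]
  linarith

/-- An entire function of exponential growth rate at most `π` in the imaginary direction that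
vanishes on the integers is a multiple of `sin πz`. The quotient is bounded away from the real
line, hence on the boundary of each rectangle around an integer, so it is constant by the maximum
principle and Liouville's theorem. -/
theorem eq_const_mul_sin_of_forall_int {f : ℂ → ℂ} {M : ℝ} (hd : Differentiable ℂ f)
    (h : ∀ z, ‖f z‖ ≤ M * Real.exp (Real.pi * |z.im|)) (h0 : ∀ n : ℤ, f n = 0) :
    ∃ c : ℂ, ∀ z, f z = c * Complex.sin (Real.pi * z) := by
  classical
  have hM : 0 ≤ M := by simpa using (norm_nonneg _).trans (h 0)
  set s : ℂ → ℂ := fun z => Complex.sin (Real.pi * z) with hs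
  have hsd : Differentiable ℂ s := by fun_prop
  have hpi : (Real.pi : ℂ) ≠ 0 := by exact_mod_cast Real.pi_ne_zero
  have hsz : ∀ z, s z = 0 ↔ ∃ n : ℤ, z = n := by
    intro z
    simp only [hs, Complex.sin_eq_zero_iff]
    refine exists_congr fun n => ?_
    rw [mul_comm]
    exact mul_left_inj' hpi
  have hds : ∀ n : ℤ, deriv s n ≠ 0 := by
    intro n
    have h1 : HasDerivAt s (Complex.cos (Real.pi * n) * Real.pi) n := by
      simpa using! ((hasDerivAt_id (n : ℂ)).const_mul (Real.pi : ℂ)).csin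
    rw [h1.deriv]
    refine mul_ne_zero ?_ hpi
    intro hc
    have h2 := (hsz n).2 ⟨n, rfl⟩
    have h3 := Complex.sin_sq_add_cos_sq (Real.pi * n)
    rw [hc] at h3
    simp only [hs] at h2
    simp [h2] at h3
  -- the quotient `f / s`, with its removable singularities at the zeros of `s` filled in
  set q : ℂ → ℂ := fun z => if s z = 0 then deriv f z / deriv s z else f z / s z with hq
  -- near an integer `n` it is a quotient of the difference slopes of `f` and `s` at `n`
  have hqd : Differentiable ℂ q := by
    intro z
    by_cases hz : s z = 0
    · obtain ⟨n, rfl⟩ := (hsz z).1 hz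
      have hev : q =ᶠ[nhds (n : ℂ)] fun w => dslope f n w / dslope s n w := by
        filter_upwards [Metric.ball_mem_nhds (n : ℂ) one_pos] with w hw
        by_cases hwn : w = n
        · subst hwn
          simp [hq, hz]
        · have hw0 : s w ≠ 0 := by
            intro hw0
            obtain ⟨m, rfl⟩ := (hsz w).1 hw0
            rw [Metric.mem_ball, Complex.dist_eq] at hw
            have : |m - n| < 1 := by
              rw [← Int.cast_sub, Complex.norm_intCast] at hw
              exact_mod_cast hw
            rw [Int.abs_lt_one_iff, sub_eq_zero] at this
            exact hwn (by rw [this])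
          have hwn' : w - n ≠ 0 := sub_ne_zero.2 hwn
          simp only [hq, hw0, if_false, dslope_of_ne _ hwn, slope_def_field, h0, hz, sub_zero]
          field_simp
      refine DifferentiableAt.congr_of_eventuallyEq ?_ hev
      have hf1 : DifferentiableAt ℂ (dslope f n) n :=
        ((Complex.differentiableOn_dslope (c := (n : ℂ)) univ_mem).2
          hd.differentiableOn).differentiableAt univ_mem
      have hs1 : DifferentiableAt ℂ (dslope s n) n :=
        ((Complex.differentiableOn_dslope (c := (n : ℂ)) univ_mem).2
          hsd.differentiableOn).differentiableAt univ_mem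
      exact hf1.div hs1 (by simpa using hds n)
    · have hev : q =ᶠ[nhds z] fun w => f w / s w := by
        filter_upwards [hsd.continuous.continuousAt.eventually_ne hz] with w hw
        simp [hq, hw]
      exact ((hd z).div (hsd z) hz).congr_of_eventuallyEq hev
  have hfq : ∀ z, f z = q z * s z := by
    intro z
    by_cases hz : s z = 0
    · obtain ⟨n, rfl⟩ := (hsz z).1 hz
      rw [hz, h0, mul_zero]
    · simp [hq, hz]
  have hq1 : ∀ z : ℂ, 1 ≤ |z.im| → ‖q z‖ ≤ 4 * M := by
    intro z hz
    have h1 := h z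
    rw [hfq, norm_mul] at h1
    have h2 : Real.exp (Real.pi * |z.im|) / 4 ≤ ‖s z‖ := by
      have h3 := sinh_abs_le_norm_sin (Real.pi * z)
      rw [Complex.im_ofReal_mul, abs_mul, abs_of_pos Real.pi_pos] at h3
      refine (exp_div_four_le_sinh ?_).trans h3
      nlinarith [Real.pi_gt_three]
    have h3 : ‖q z‖ * (Real.exp (Real.pi * |z.im|) / 4) ≤ M * Real.exp (Real.pi * |z.im|) :=
      (mul_le_mul_of_nonneg_left h2 (norm_nonneg _)).trans h1
    have h4 := Real.exp_pos (Real.pi * |z.im|)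
    by_contra! hcon
    nlinarith
  set B := max (4 * M) (M * Real.exp Real.pi) with hB
  have hqB : ∀ z, ‖q z‖ ≤ B := by
    intro z
    rcases le_total 1 |z.im| with hz | hz
    · exact (hq1 z hz).trans (le_max_left _ _)
    set n := round z.re with hn
    have hround := abs_sub_round z.re
    have hlt : (n : ℝ) - 1 / 2 < n + 1 / 2 := by linarith
    -- maximum principle on the rectangle of width one around `n`; on its vertical sides
    -- `sin (π Re w) = ±1`
    refine Complex.norm_le_of_forall_mem_frontier_norm_le
      (U := Set.Ioo ((n : ℝ) - 1 / 2) (n + 1 / 2) ×ℂ Set.Ioo (-1) 1)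
      ((Metric.isBounded_Ioo _ _).reProdIm (Metric.isBounded_Ioo _ _)) hqd.diffContOnCl ?_ ?_
    · intro w hw
      rw [Complex.frontier_reProdIm, closure_Ioo hlt.ne, closure_Ioo (by norm_num),
        frontier_Ioo hlt, frontier_Ioo (by norm_num)] at hw
      rcases hw with hw | hw
      · refine (hq1 w ?_).trans (le_max_left _ _)
        obtain h' | h' : w.im = -1 ∨ w.im = 1 := hw.2 <;> rw [h'] <;> norm_num
      · refine le_trans ?_ (le_max_right _ _)
        have h1 := h w
        rw [hfq, norm_mul] at h1
        have him : |w.im| ≤ 1 := abs_le.2 hw.2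
        have hs1 : 1 ≤ ‖s w‖ := by
          have h2 := norm_sin_sq (Real.pi * w)
          rw [Complex.re_ofReal_mul] at h2
          have h3 : Real.sin (Real.pi * w.re) ^ 2 = 1 := by
            have hcos : Real.cos (Real.pi * w.re) = 0 := by
              rw [Real.cos_eq_zero_iff]
              obtain h' | h' : w.re = n - 1 / 2 ∨ w.re = n + 1 / 2 := hw.1
              · exact ⟨n - 1, by rw [h']; push_cast; ring⟩
              · exact ⟨n, by rw [h']; ring⟩
            have := Real.sin_sq_add_cos_sq (Real.pi * w.re)
            rw [hcos] at this
            linarith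
          nlinarith [sq_nonneg (Real.sinh (Real.pi * w : ℂ).im), norm_nonneg (s w)]
        calc ‖q w‖ ≤ ‖q w‖ * ‖s w‖ := le_mul_of_one_le_right (norm_nonneg _) hs1
          _ ≤ _ := h1
          _ ≤ _ := by
            gcongr
            nlinarith [Real.pi_pos]
    · rw [Complex.closure_reProdIm, closure_Ioo hlt.ne, closure_Ioo (by norm_num)]
      rw [abs_le] at hround
      exact ⟨⟨by linarith [hround.1], by linarith [hround.2]⟩, abs_le.1 hz⟩
  have hbdd : Bornology.IsBounded (Set.range q) := by
    refine (Metric.isBounded_closedBall (x := (0 : ℂ)) (r := B)).subset ?_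
    rintro _ ⟨z, rfl⟩
    simpa using hqB z
  obtain ⟨c, hc⟩ := hqd.exists_const_forall_eq_of_bounded hbdd
  exact ⟨c, fun z => by rw [hfq, hc]⟩

/-! ### A discrete Young inequality -/

/-- The summable kernel `1 / (k² + 1)`. -/
def cauchyKernel (k : ℤ) : ℝ := ((k : ℝ) ^ 2 + 1)⁻¹

theorem cauchyKernel_pos (k : ℤ) : 0 < cauchyKernel k := by
  unfold cauchyKernel; positivity

theorem summable_cauchyKernel : Summable cauchyKernel := by
  have h := (Real.summable_one_div_int_pow (p := 2)).2 one_lt_two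
  refine Summable.of_norm_bounded_eventually h ?_
  rw [Filter.eventually_cofinite]
  refine (Set.finite_singleton (0 : ℤ)).subset fun k hk => ?_
  by_contra hk0
  refine hk ?_
  have hk' : (0 : ℝ) < (k : ℝ) ^ 2 := by
    have : (k : ℝ) ≠ 0 := by exact_mod_cast hk0
    positivity
  rw [Real.norm_of_nonneg (cauchyKernel_pos k).le, cauchyKernel, one_div]
  gcongr
  linarith

/-- The `ℓ¹` norm of the kernel. -/
def kernelSum : ℝ := ∑' k, cauchyKernel k

theorem kernelSum_pos : 0 < kernelSum :=
  summable_cauchyKernel.tsum_pos (fun k => (cauchyKernel_pos k).le) 0 (cauchyKernel_pos 0)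

theorem sum_cauchyKernel_le (M : Finset ℤ) (e : ℤ ≃ ℤ) :
    ∑ m ∈ M, cauchyKernel (e m) ≤ kernelSum := by
  have hs : Summable fun m => cauchyKernel (e m) := (e.summable_iff).2 summable_cauchyKernel
  refine (hs.sum_le_tsum M fun k _ => (cauchyKernel_pos _).le).trans ?_
  rw [e.tsum_eq cauchyKernel, kernelSum]

/-- Convolution with the kernel is bounded on `ℓ^p`. -/
theorem sum_conv_rpow_le {p : ℝ} (hp : 1 ≤ p) (S M : Finset ℤ) (a : ℤ → ℝ) (ha : ∀ n, 0 ≤ a n) :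
    ∑ m ∈ M, (∑ n ∈ S, cauchyKernel (m - n) * a n) ^ p ≤ kernelSum ^ p * ∑ n ∈ S, a n ^ p := by
  have hp0 : 0 < p := by linarith
  have hK := kernelSum_pos
  have step : ∀ m : ℤ, (∑ n ∈ S, cauchyKernel (m - n) * a n) ^ p ≤
      kernelSum ^ (p - 1) * ∑ n ∈ S, cauchyKernel (m - n) * a n ^ p := by
    intro m
    have hs : 0 ≤ ∑ n ∈ S, cauchyKernel (m - n) * a n ^ p :=
      Finset.sum_nonneg fun n _ => mul_nonneg (cauchyKernel_pos _).le (Real.rpow_nonneg (ha n) _)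
    have h1 := Real.inner_le_weight_mul_Lp_of_nonneg S hp (fun n => cauchyKernel (m - n)) a
      (fun n => (cauchyKernel_pos _).le) ha
    have h2 : ∑ n ∈ S, cauchyKernel (m - n) ≤ kernelSum := sum_cauchyKernel_le S (Equiv.subLeft m)
    have hw : 0 ≤ ∑ n ∈ S, cauchyKernel (m - n) :=
      Finset.sum_nonneg fun n _ => (cauchyKernel_pos _).le
    calc (∑ n ∈ S, cauchyKernel (m - n) * a n) ^ p
        ≤ (kernelSum ^ (1 - p⁻¹) * (∑ n ∈ S, cauchyKernel (m - n) * a n ^ p) ^ p⁻¹) ^ p := by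
          have h3 : 0 ≤ 1 - p⁻¹ := by
            rw [sub_nonneg]; exact inv_le_one_of_one_le₀ hp
          refine Real.rpow_le_rpow (Finset.sum_nonneg fun n _ =>
            mul_nonneg (cauchyKernel_pos _).le (ha n)) (h1.trans ?_) hp0.le
          gcongr
      _ = _ := by
          rw [Real.mul_rpow (by positivity) (by positivity), ← Real.rpow_mul hK.le,
            ← Real.rpow_mul hs, inv_mul_cancel₀ hp0.ne', Real.rpow_one, sub_mul, one_mul,
            inv_mul_cancel₀ hp0.ne']
  calc ∑ m ∈ M, (∑ n ∈ S, cauchyKernel (m - n) * a n) ^ p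
      ≤ ∑ m ∈ M, kernelSum ^ (p - 1) * ∑ n ∈ S, cauchyKernel (m - n) * a n ^ p :=
        Finset.sum_le_sum fun m _ => step m
    _ = kernelSum ^ (p - 1) * ∑ n ∈ S, (∑ m ∈ M, cauchyKernel (m - n)) * a n ^ p := by
        rw [← Finset.mul_sum, Finset.sum_comm]
        simp only [Finset.sum_mul]
    _ ≤ kernelSum ^ (p - 1) * ∑ n ∈ S, kernelSum * a n ^ p := by
        gcongr with n
        · exact Real.rpow_nonneg (ha n) _
        · exact sum_cauchyKernel_le M (Equiv.subRight n)
    _ = _ := by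
        rw [← Finset.mul_sum, ← mul_assoc]
        congr 1
        nth_rewrite 2 [← Real.rpow_one kernelSum]
        rw [← Real.rpow_add hK, sub_add_cancel]

theorem add_rpow_le {a b p : ℝ} (ha : 0 ≤ a) (hb : 0 ≤ b) (hp : 0 ≤ p) :
    (a + b) ^ p ≤ 2 ^ p * (a ^ p + b ^ p) := by
  have h1 : a + b ≤ 2 * max a b := by linarith [le_max_left a b, le_max_right a b]
  have h2 : 0 ≤ max a b := ha.trans (le_max_left _ _)
  calc (a + b) ^ p ≤ (2 * max a b) ^ p := by gcongr
    _ = 2 ^ p * max a b ^ p := Real.mul_rpow zero_le_two h2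
    _ ≤ _ := by
      gcongr
      rcases max_choice a b with h | h <;> rw [h]
      · linarith [Real.rpow_nonneg hb p]
      · linarith [Real.rpow_nonneg ha p]

/-! ### The Cauchy transform of a finite sequence -/

/-- The Cauchy transform `∑ d_n / (z - n)` of a finite sequence. -/
def cauchyTransform (S : Finset ℤ) (d : ℤ → ℂ) (z : ℂ) : ℂ := ∑ n ∈ S, d n / (z - n)

theorem one_le_norm_sub_int {z : ℂ} (hz : 1 ≤ z.im) (n : ℤ) : 1 ≤ ‖z - n‖ := by
  have := Complex.abs_im_le_norm (z - n)
  simp only [Complex.sub_im, Complex.intCast_im, sub_zero] at this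
  exact (hz.trans (le_abs_self _)).trans this

theorem sub_int_ne_zero {z : ℂ} (hz : 0 < z.im) (n : ℤ) : z - n ≠ 0 := by
  intro h
  have := congrArg Complex.im h
  simp at this
  exact hz.ne' this

theorem differentiableAt_cauchyTransform (S : Finset ℤ) (d : ℤ → ℂ) {z : ℂ} (hz : 0 < z.im) :
    DifferentiableAt ℂ (cauchyTransform S d) z := by
  unfold cauchyTransform
  refine DifferentiableAt.fun_sum fun n _ => ?_
  exact (differentiableAt_const _).div (by fun_prop) (sub_int_ne_zero hz n)

theorem exists_norm_cauchyTransform_le (S : Finset ℤ) (d : ℤ → ℂ) :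
    ∃ D : ℝ, 0 ≤ D ∧ ∀ z : ℂ, 1 ≤ z.im → ‖cauchyTransform S d z‖ ≤ D / ‖z‖ := by
  refine ⟨∑ n ∈ S, ‖d n‖ * (1 + |(n : ℝ)|), by positivity, fun z hz => ?_⟩
  rw [Finset.sum_div]
  refine (norm_sum_le _ _).trans (Finset.sum_le_sum fun n _ => ?_)
  have h1 := one_le_norm_sub_int hz n
  have h0 : 0 < ‖z‖ := by
    rw [norm_pos_iff]; rintro rfl; simp at hz; linarith
  have h2 : ‖z‖ ≤ ‖z - n‖ * (1 + |(n : ℝ)|) := by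
    have h3 : ‖z‖ ≤ ‖z - n‖ + |(n : ℝ)| := by
      calc ‖z‖ = ‖(z - n) + n‖ := by ring_nf
        _ ≤ _ := (norm_add_le _ _).trans (by rw [Complex.norm_intCast])
    nlinarith [abs_nonneg (n : ℝ)]
  rw [norm_div, div_le_div_iff₀ (by linarith) h0, mul_assoc]
  gcongr
  linarith

/-- A holomorphic function in the half-plane above `Im z = 1` that decays faster than `1 / |z|`
integrates to zero along the boundary line, by Cauchy's theorem on growing squares. -/
theorem integral_line_eq_zero {H : ℂ → ℂ} {p C : ℝ} (hp : 1 < p)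
    (hd : ∀ z : ℂ, 1 ≤ z.im → DifferentiableAt ℂ H z)
    (hH : ∀ z : ℂ, 1 ≤ z.im → ‖H z‖ ≤ C / ‖z‖ ^ p) :
    Integrable (fun x : ℝ => H (x + Complex.I)) ∧ ∫ x : ℝ, H (x + Complex.I) = 0 := by
  have hp0 : 0 < p := by linarith
  have hC : 0 ≤ C := by
    have := (norm_nonneg _).trans (hH Complex.I (by simp))
    simpa using this
  have hint : Integrable (fun x : ℝ => H (x + Complex.I)) := by
    have hj := (integrable_rpow_neg_one_add_norm_sq (E := ℝ) (μ := volume) (r := p)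
      (by simpa using hp)).const_mul C
    refine hj.mono' (Continuous.aestronglyMeasurable ?_) (Eventually.of_forall fun x => ?_)
    · rw [continuous_iff_continuousAt]
      intro x
      have h1 : ContinuousAt H (x + Complex.I) := (hd _ (by simp)).continuousAt
      exact ContinuousAt.comp (f := fun x : ℝ => (x : ℂ) + Complex.I) h1 (by fun_prop)
    · refine (hH _ (by simp)).trans (le_of_eq ?_)
      have h1 : ‖(x : ℂ) + Complex.I‖ = (1 + ‖x‖ ^ 2) ^ (1 / 2 : ℝ) := by
        rw [← Real.sqrt_eq_rpow, Complex.norm_eq_sqrt_sq_add_sq]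
        simp [add_comm]
      rw [h1, ← Real.rpow_mul (by positivity), div_eq_mul_inv, ← Real.rpow_neg (by positivity)]
      congr 2
      ring
  refine ⟨hint, ?_⟩
  have hlim := intervalIntegral_tendsto_integral hint tendsto_neg_atTop_atBot tendsto_id
  refine tendsto_nhds_unique hlim ?_
  have hbound : ∀ᶠ R : ℝ in atTop,
      ‖∫ x in (-R)..(id R), H (x + Complex.I)‖ ≤ 4 * C * R ^ (-(p - 1)) := by
    filter_upwards [eventually_gt_atTop 0] with R hR
    have hsmall : ∀ z : ℂ, 1 ≤ z.im → R ≤ ‖z‖ → ‖H z‖ ≤ C * R ^ (-p) := by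
      intro z hz hRz
      refine (hH z hz).trans ?_
      rw [Real.rpow_neg hR.le, ← div_eq_mul_inv]
      gcongr
    have hrect := Complex.integral_boundary_rect_eq_zero_of_differentiableOn H
      ((-R : ℝ) + (1 : ℝ) * Complex.I) (R + (1 + R : ℝ) * Complex.I) ?_
    · simp only [Complex.add_re, Complex.ofReal_re, Complex.mul_re, Complex.I_re, mul_zero,
        Complex.ofReal_im, Complex.I_im, mul_one, sub_self, add_zero, Complex.add_im,
        Complex.mul_im, zero_add, Complex.ofReal_one, one_mul] at hrect
      have htop : ‖∫ x in (-R)..R, H (x + (1 + R : ℝ) * Complex.I)‖ ≤ C * R ^ (-p) * (2 * R) := by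
        have := intervalIntegral.norm_integral_le_of_norm_le_const (a := -R) (b := R)
          (f := fun x : ℝ => H (x + (1 + R : ℝ) * Complex.I)) (C := C * R ^ (-p)) ?_
        · rwa [sub_neg_eq_add, ← two_mul, abs_of_pos (by linarith)] at this
        · intro x _
          refine hsmall _ (by simp; linarith) ?_
          refine le_trans ?_ (Complex.abs_im_le_norm _)
          simp
          rw [abs_of_pos (by linarith)]; linarith
      have hside : ∀ s : ℝ, |s| = R →
          ‖∫ y in (1 : ℝ)..(1 + R), H (s + y * Complex.I)‖ ≤ C * R ^ (-p) * R := by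
        intro s hs
        have := intervalIntegral.norm_integral_le_of_norm_le_const (a := 1) (b := 1 + R)
          (f := fun y : ℝ => H (s + y * Complex.I)) (C := C * R ^ (-p)) ?_
        · rwa [add_sub_cancel_left, abs_of_pos hR] at this
        · intro y hy
          rw [Set.uIoc_of_le (by linarith)] at hy
          refine hsmall _ (by simp; linarith [hy.1]) ?_
          refine le_trans ?_ (Complex.abs_re_le_norm _)
          simp [hs]
      have hr := hside R (abs_of_pos hR)
      have hl := hside (-R) (by rw [abs_neg, abs_of_pos hR])
      have heq : ∫ x in (-R)..R, H (x + Complex.I) =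
          (∫ x in (-R)..R, H (x + (1 + R : ℝ) * Complex.I)) -
          Complex.I * (∫ y in (1 : ℝ)..(1 + R), H (R + y * Complex.I)) +
          Complex.I * (∫ y in (1 : ℝ)..(1 + R), H ((-R : ℝ) + y * Complex.I)) := by
        simp only [smul_eq_mul] at hrect
        linear_combination hrect
      simp only [id]
      rw [heq]
      have hpow : R ^ (-(p - 1)) = R ^ (-p) * R := by
        nth_rewrite 3 [← Real.rpow_one R]
        rw [← Real.rpow_add hR]; ring_nf
      rw [hpow]
      refine (norm_add_le _ _).trans ?_
      refine (add_le_add_left (norm_sub_le _ _) _).trans ?_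
      rw [norm_mul, norm_mul, Complex.norm_I, one_mul, one_mul]
      linarith
    · intro z hz
      refine (hd z ?_).differentiableWithinAt
      have := hz.2
      simp only [Complex.add_im, Complex.ofReal_im, Complex.mul_im, Complex.ofReal_re,
        Complex.I_im, mul_one, Complex.I_re, mul_zero, add_zero, zero_add, Set.mem_preimage] at this
      rw [Set.uIcc_of_le (by linarith)] at this
      exact this.1
  refine squeeze_zero_norm' hbound ?_
  have := (tendsto_rpow_neg_atTop (y := p - 1) (by linarith)).const_mul (4 * C)
  simpa using this

/-- For `1 < p ≤ 2` the function `cos (pφ)` is negative near `|φ| = π/2`, where `cos φ` is small. -/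
theorem exists_one_le_cos {p : ℝ} (hp : 1 < p) (hp2 : p ≤ 2) :
    ∃ A B : ℝ, 0 ≤ A ∧ 0 ≤ B ∧ ∀ φ : ℝ, |φ| ≤ Real.pi / 2 →
      1 ≤ A * Real.cos φ ^ p - B * Real.cos (φ * p) := by
  have hp0 : 0 < p := by linarith
  have hpi := Real.pi_pos
  -- a threshold beyond which `cos (pφ)` is negative; below it `cos φ` is bounded away from zero
  obtain ⟨φ₀, h1, h2⟩ : ∃ φ₀, Real.pi / (2 * p) < φ₀ ∧ φ₀ < Real.pi / 2 := by
    refine exists_between ?_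
    gcongr
    linarith
  have h0 : 0 < φ₀ := lt_trans (by positivity) h1
  have h1' : Real.pi / 2 < φ₀ * p := by
    rw [div_lt_iff₀ (by positivity)] at h1
    linarith
  have h2' : φ₀ * p ≤ Real.pi := by nlinarith
  have hc1 : Real.cos (φ₀ * p) < 0 :=
    Real.cos_neg_of_pi_div_two_lt_of_lt h1' (by linarith)
  have hc2 : 0 < Real.cos φ₀ := Real.cos_pos_of_mem_Ioo ⟨by linarith, h2⟩
  set B := (-Real.cos (φ₀ * p))⁻¹ with hB
  have hB0 : 0 < B := inv_pos.2 (by linarith)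
  have hc3 : 0 < Real.cos φ₀ ^ p := Real.rpow_pos_of_pos hc2 p
  refine ⟨(1 + B) / Real.cos φ₀ ^ p, B, by positivity, hB0.le, fun φ hφ => ?_⟩
  have hcosφ : Real.cos φ = Real.cos |φ| := (Real.cos_abs φ).symm
  have hcosp : Real.cos (φ * p) = Real.cos (|φ| * p) := by
    rw [← Real.cos_abs (φ * p), abs_mul, abs_of_pos hp0]
  rw [hcosφ, hcosp]
  set ψ := |φ|
  have hψ : 0 ≤ ψ := abs_nonneg φ
  have hcψ : 0 ≤ Real.cos ψ := Real.cos_nonneg_of_mem_Icc ⟨by linarith, hφ⟩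
  rcases le_total ψ φ₀ with h | h
  · have h3 : Real.cos φ₀ ≤ Real.cos ψ :=
      Real.cos_le_cos_of_nonneg_of_le_pi hψ (by linarith) h
    have h4 : 1 + B ≤ (1 + B) / Real.cos φ₀ ^ p * Real.cos ψ ^ p := by
      rw [div_mul_eq_mul_div, le_div_iff₀ hc3]
      gcongr
    have h5 := Real.cos_le_one (ψ * p)
    nlinarith
  · have h3 : Real.cos (ψ * p) ≤ Real.cos (φ₀ * p) :=
      Real.cos_le_cos_of_nonneg_of_le_pi (by positivity) (by nlinarith) (by gcongr)
    have h4 : 1 ≤ -(B * Real.cos (ψ * p)) := by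
      have : B * -Real.cos (φ₀ * p) = 1 := inv_mul_cancel₀ (by linarith)
      nlinarith
    have h5 : 0 ≤ (1 + B) / Real.cos φ₀ ^ p * Real.cos ψ ^ p := by positivity
    linarith

/-! ### The theorem of M. Riesz on `ℓ^p` -/

/-- An integral over the line is bounded by the sum of bounds on the unit cells; cell boundaries are
null sets and need no bound. -/
theorem lintegral_le_of_cells {g : ℝ → ℝ≥0∞} {b : ℤ → ℝ} {B : ℝ} (hb : ∀ m, 0 ≤ b m)
    (h : ∀ m : ℤ, ∀ x ∈ Set.Ioo (m : ℝ) (m + 1), g x ≤ ENNReal.ofReal (b m))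
    (hB : ∀ M : Finset ℤ, ∑ m ∈ M, b m ≤ B) : ∫⁻ x, g x ≤ ENNReal.ofReal B := by
  rw [← setLIntegral_univ, ← iUnion_Ioc_intCast (α := ℝ),
    lintegral_iUnion (fun m => measurableSet_Ioc) (Set.pairwise_disjoint_Ioc_intCast ℝ)]
  refine ENNReal.summable.tsum_le_of_sum_le fun M => ?_
  calc ∑ m ∈ M, ∫⁻ x in Set.Ioc (m : ℝ) (m + 1), g x
      ≤ ∑ m ∈ M, ENNReal.ofReal (b m) := by
        refine Finset.sum_le_sum fun m _ => ?_
        rw [restrict_Ioo_eq_restrict_Ioc.symm]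
        calc ∫⁻ x in Set.Ioo (m : ℝ) (m + 1), g x
            ≤ ∫⁻ x in Set.Ioo (m : ℝ) (m + 1), ENNReal.ofReal (b m) :=
              setLIntegral_mono' measurableSet_Ioo (h m)
          _ = _ := by simp
    _ = ENNReal.ofReal (∑ m ∈ M, b m) := (ENNReal.ofReal_sum_of_nonneg fun m _ => hb m).symm
    _ ≤ _ := ENNReal.ofReal_le_ofReal (hB M)

theorem sum_cell_integral_le {h : ℝ → ℝ} (hi : Integrable h) (h0 : ∀ x, 0 ≤ h x) (M : Finset ℤ) :
    ∑ m ∈ M, ∫ x in Set.Ioc (m : ℝ) (m + 1), h x ≤ ∫ x, h x := by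
  rw [← integral_biUnion_finset M (fun m _ => measurableSet_Ioc)
    (fun i _ j _ hij => Set.pairwise_disjoint_Ioc_intCast ℝ hij) (fun m _ => hi.integrableOn)]
  exact setIntegral_le_integral hi (Eventually.of_forall h0)

theorem norm_int_add_I_sub_sq (m n : ℤ) :
    ‖(m : ℂ) + Complex.I - n‖ ^ 2 = (cauchyKernel (m - n))⁻¹ := by
  rw [cauchyKernel, inv_inv, Complex.sq_norm, Complex.normSq_apply]
  simp
  ring

theorem norm_int_add_I_sub_le {m n : ℤ} {x : ℝ} (hx : x ∈ Set.Ioo (m : ℝ) (m + 1)) :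
    ‖(m : ℂ) + Complex.I - n‖ ≤ 2 * ‖(x : ℂ) + Complex.I - n‖ := by
  have h1 : 1 ≤ ‖(x : ℂ) + Complex.I - n‖ := one_le_norm_sub_int (by simp) n
  have h2 : ‖((m - x : ℝ) : ℂ)‖ ≤ 1 := by
    rw [Complex.norm_real, Real.norm_eq_abs, abs_le]
    constructor <;> linarith [hx.1, hx.2]
  calc ‖(m : ℂ) + Complex.I - n‖ = ‖((x : ℂ) + Complex.I - n) + ((m - x : ℝ) : ℂ)‖ := by
        congr 1; push_cast; ring
    _ ≤ _ := norm_add_le _ _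
    _ ≤ _ := by linarith

theorem inv_norm_sq_le {m n : ℤ} {x : ℝ} (hx : x ∈ Set.Ioo (m : ℝ) (m + 1)) :
    (‖(x : ℂ) + Complex.I - n‖ ^ 2)⁻¹ ≤ 4 * cauchyKernel (m - n) := by
  have h1 : 1 ≤ ‖(x : ℂ) + Complex.I - n‖ := one_le_norm_sub_int (by simp) n
  have h2 := norm_int_add_I_sub_le (n := n) hx
  have h3 := norm_int_add_I_sub_sq m n
  have h4 := cauchyKernel_pos (m - n)
  rw [inv_le_iff_one_le_mul₀ (by positivity)]
  have h5 : (cauchyKernel (m - n))⁻¹ ≤ 4 * ‖(x : ℂ) + Complex.I - n‖ ^ 2 := by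
    rw [← h3]
    nlinarith [norm_nonneg ((m : ℂ) + Complex.I - n)]
  rw [inv_le_iff_one_le_mul₀ h4] at h5
  linarith

/-- The value at the lattice point `m + i` is compared with the values on the line `Im z = 1` over
the cell to its right: each term changes by at most a multiple of the summable kernel. -/
theorem norm_cauchyTransform_sub_le (S : Finset ℤ) (d : ℤ → ℂ) {m : ℤ} {x : ℝ}
    (hx : x ∈ Set.Ioo (m : ℝ) (m + 1)) :
    ‖cauchyTransform S d (m + Complex.I)‖ ≤ ‖cauchyTransform S d (x + Complex.I)‖ +
      2 * ∑ n ∈ S, cauchyKernel (m - n) * ‖d n‖ := by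
  have key : ‖cauchyTransform S d (m + Complex.I) - cauchyTransform S d (x + Complex.I)‖ ≤
      2 * ∑ n ∈ S, cauchyKernel (m - n) * ‖d n‖ := by
    rw [cauchyTransform, cauchyTransform, ← Finset.sum_sub_distrib, Finset.mul_sum]
    refine (norm_sum_le _ _).trans (Finset.sum_le_sum fun n _ => ?_)
    have h1 : (x : ℂ) + Complex.I - n ≠ 0 := sub_int_ne_zero (by simp) n
    have h2 : (m : ℂ) + Complex.I - n ≠ 0 := sub_int_ne_zero (by simp) n
    have h3 : d n / ((m : ℂ) + Complex.I - n) - d n / ((x : ℂ) + Complex.I - n) =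
        d n * ((x - m : ℝ) : ℂ) / (((m : ℂ) + Complex.I - n) * ((x : ℂ) + Complex.I - n)) := by
      field_simp
      push_cast
      ring
    have h4 : ‖((x - m : ℝ) : ℂ)‖ ≤ 1 := by
      rw [Complex.norm_real, Real.norm_eq_abs, abs_le]
      constructor <;> linarith [hx.1, hx.2]
    have h5 := norm_int_add_I_sub_sq m n
    have h6 := norm_int_add_I_sub_le (n := n) hx
    have h7 : 0 < ‖(m : ℂ) + Complex.I - n‖ := norm_pos_iff.2 h2
    have h8 : 0 < ‖(x : ℂ) + Complex.I - n‖ := norm_pos_iff.2 h1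
    have h9 : cauchyKernel (m - n) = (‖(m : ℂ) + Complex.I - n‖ ^ 2)⁻¹ := by rw [h5, inv_inv]
    rw [h3, norm_div, norm_mul, norm_mul, h9, div_le_iff₀ (by positivity)]
    calc ‖d n‖ * ‖((x - m : ℝ) : ℂ)‖ ≤ ‖d n‖ * 1 := by gcongr
      _ ≤ ‖d n‖ * (2 * ‖(x : ℂ) + Complex.I - n‖ / ‖(m : ℂ) + Complex.I - n‖) := by
        gcongr
        rwa [one_le_div h7]
      _ = _ := by field_simp
  have := norm_sub_norm_le (cauchyTransform S d (m + Complex.I))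
    (cauchyTransform S d (x + Complex.I))
  linarith

/-- For a nonnegative sequence the function `i ∑ r_n / (z - n)` maps the upper half-plane to the
right half-plane, so its `p`-th power is holomorphic and integrates to zero along `Im z = 1`.
Together with `exists_one_le_cos` this bounds its `L^p` norm by that of its real part, a Poisson
sum. -/
theorem exists_sum_cauchyTransform_le_of_nonneg {p : ℝ} (hp : 1 < p) (hp2 : p ≤ 2) :
    ∃ C : ℝ, 0 ≤ C ∧ ∀ (S M : Finset ℤ) (r : ℤ → ℝ), (∀ n, 0 ≤ r n) →
      ∑ m ∈ M, ‖cauchyTransform S (fun n => (r n : ℂ)) (m + Complex.I)‖ ^ p ≤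
        C * ∑ n ∈ S, r n ^ p := by
  obtain ⟨A, B, hA, hB, hAB⟩ := exists_one_le_cos hp hp2
  have hp0 : 0 < p := by linarith
  have hK := kernelSum_pos
  refine ⟨2 ^ p * (A * (4 ^ p * kernelSum ^ p) + 2 ^ p * kernelSum ^ p), by positivity,
    fun S M r hr => ?_⟩
  have hRS : 0 ≤ ∑ n ∈ S, r n ^ p := Finset.sum_nonneg fun n _ => Real.rpow_nonneg (hr n) _
  by_cases hzero : ∀ n ∈ S, r n = 0
  · have : ∀ z, cauchyTransform S (fun n => (r n : ℂ)) z = 0 := fun z =>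
      Finset.sum_eq_zero fun n hn => by simp [hzero n hn]
    simp only [this, norm_zero, Real.zero_rpow hp0.ne', Finset.sum_const_zero]
    positivity
  push Not at hzero
  obtain ⟨n₀, hn₀, hrn₀⟩ := hzero
  set F := cauchyTransform S (fun n => (r n : ℂ)) with hF
  -- the real part of `G` is a Poisson sum; it is positive because some `r n` is
  set G : ℂ → ℂ := fun z => Complex.I * F z with hG
  have hGF : ∀ z, ‖G z‖ = ‖F z‖ := fun z => by simp [hG]
  have hGre : ∀ z : ℂ, (G z).re = ∑ n ∈ S, r n * (z.im * (‖z - n‖ ^ 2)⁻¹) := by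
    intro z
    simp only [hG, hF, cauchyTransform, Finset.mul_sum, Complex.re_sum]
    refine Finset.sum_congr rfl fun n _ => ?_
    rw [Complex.sq_norm, Complex.I_mul_re, Complex.div_im]
    simp
    ring
  have hGpos : ∀ z : ℂ, 0 < z.im → 0 < (G z).re := by
    intro z hz
    rw [hGre]
    refine Finset.sum_pos' (fun n _ => mul_nonneg (hr n) (by positivity)) ⟨n₀, hn₀, ?_⟩
    have h1 := norm_pos_iff.2 (sub_int_ne_zero hz n₀)
    have h2 := (hr n₀).lt_of_ne hrn₀.symm
    positivity
  set H : ℂ → ℂ := fun z => G z ^ (p : ℂ) with hH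
  have hHn : ∀ z, ‖H z‖ = ‖F z‖ ^ p := fun z => by rw [hH, Complex.norm_cpow_real, hGF]
  obtain ⟨D, hD0, hD⟩ := exists_norm_cauchyTransform_le S (fun n => (r n : ℂ))
  obtain ⟨hHi, hH0⟩ := integral_line_eq_zero (H := H) (C := D ^ p) hp
    (fun z hz => by
      have hz0 : 0 < z.im := by linarith
      have hG1 : DifferentiableAt ℂ G z :=
        (differentiableAt_const _).mul (differentiableAt_cauchyTransform S _ hz0)
      exact hG1.cpow (differentiableAt_const _) (Or.inl (hGpos z hz0)))
    (fun z hz => by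
      rw [hHn, ← Real.div_rpow hD0 (norm_nonneg z)]
      exact Real.rpow_le_rpow (norm_nonneg _) (hD z hz) hp0.le)
  set u : ℝ → ℝ := fun x => (G (x + Complex.I)).re with hu
  have hu0 : ∀ x, 0 < u x := fun x => hGpos _ (by simp)
  -- `exists_one_le_cos` at `φ = arg w`, scaled by `‖w‖ ^ p`
  have hpt : ∀ x : ℝ, ‖F (x + Complex.I)‖ ^ p ≤ A * u x ^ p - B * (H (x + Complex.I)).re := by
    intro x
    set w := G (x + Complex.I) with hw
    have hw0 : 0 < w.re := hu0 x
    have harg : |w.arg| ≤ Real.pi / 2 := Complex.abs_arg_le_pi_div_two_iff.2 hw0.le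
    have h1 := hAB w.arg harg
    have h2 : u x = ‖w‖ * Real.cos w.arg := (Complex.norm_mul_cos_arg w).symm
    have h3 : (H (x + Complex.I)).re = ‖w‖ ^ p * Real.cos (w.arg * p) := Complex.cpow_ofReal_re _ _
    have h4 : 0 ≤ Real.cos w.arg := Real.cos_nonneg_of_mem_Icc (abs_le.1 harg)
    rw [h2, h3, Real.mul_rpow (norm_nonneg _) h4, ← hGF, ← hw]
    have h5 : 0 ≤ ‖w‖ ^ p := by positivity
    nlinarith
  have hFi : Integrable fun x : ℝ => ‖F (x + Complex.I)‖ ^ p := by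
    simpa only [hHn] using hHi.norm
  have huc : Continuous u := by
    rw [continuous_iff_continuousAt]
    intro x
    have h1 : ContinuousAt G (x + Complex.I) :=
      ((differentiableAt_const _).mul
        (differentiableAt_cauchyTransform S _ (by simp))).continuousAt
    have h2 : ContinuousAt (fun x : ℝ => G (x + Complex.I)) x :=
      ContinuousAt.comp (f := fun x : ℝ => (x : ℂ) + Complex.I) h1 (by fun_prop)
    exact Complex.continuous_re.continuousAt.comp h2
  have hui : Integrable fun x => u x ^ p := by
    refine hFi.mono' (huc.rpow_const fun x => Or.inr hp0.le).aestronglyMeasurable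
      (Eventually.of_forall fun x => ?_)
    rw [Real.norm_of_nonneg (Real.rpow_nonneg (hu0 x).le _), ← hGF]
    exact Real.rpow_le_rpow (hu0 x).le (Complex.re_le_norm _) hp0.le
  have hint1 : ∫ x : ℝ, ‖F (x + Complex.I)‖ ^ p ≤ A * ∫ x, u x ^ p := by
    have h1 : ∫ x : ℝ, (H (x + Complex.I)).re = 0 := by
      have := integral_re hHi
      simp only [RCLike.re_to_complex] at this
      rw [this, hH0, Complex.zero_re]
    calc ∫ x : ℝ, ‖F (x + Complex.I)‖ ^ p
        ≤ ∫ x : ℝ, (A * u x ^ p - B * (H (x + Complex.I)).re) :=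
          integral_mono hFi ((hui.const_mul A).sub (hHi.re.const_mul B)) hpt
      _ = _ := by
        have := integral_sub (hui.const_mul A) (hHi.re.const_mul B)
        simp only [RCLike.re_to_complex] at this
        rw [this, integral_const_mul, integral_const_mul, h1, mul_zero, sub_zero]
  have hY := fun M => sum_conv_rpow_le hp.le S M r hr
  have hconv0 : ∀ m : ℤ, 0 ≤ ∑ n ∈ S, cauchyKernel (m - n) * r n := fun m =>
    Finset.sum_nonneg fun n _ => mul_nonneg (cauchyKernel_pos _).le (hr n)
  have hint2 : ∫ x, u x ^ p ≤ 4 ^ p * kernelSum ^ p * ∑ n ∈ S, r n ^ p := by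
    rw [integral_eq_lintegral_of_nonneg_ae (Eventually.of_forall fun x =>
      Real.rpow_nonneg (hu0 x).le _) hui.aestronglyMeasurable]
    refine ENNReal.toReal_le_of_le_ofReal (by positivity) ?_
    refine lintegral_le_of_cells (b := fun m => 4 ^ p * (∑ n ∈ S, cauchyKernel (m - n) * r n) ^ p)
      (fun m => mul_nonneg (by positivity) (Real.rpow_nonneg (hconv0 m) _)) (fun m x hx => ?_)
      (fun M => ?_)
    · refine ENNReal.ofReal_le_ofReal ?_
      rw [← Real.mul_rpow (by norm_num) (hconv0 m)]
      refine Real.rpow_le_rpow (hu0 x).le ?_ hp0.le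
      simp only [hu, hGre, Finset.mul_sum]
      refine Finset.sum_le_sum fun n _ => ?_
      have h1 := inv_norm_sq_le (n := n) hx
      have h2 : ((x : ℂ) + Complex.I).im = 1 := by simp
      rw [h2, one_mul]
      nlinarith [hr n]
    · rw [← Finset.mul_sum, mul_assoc]
      gcongr
      exact hY M
  -- averaging over the cell `(m, m + 1)` recovers the lattice value from the integral
  have hcell : ∀ m : ℤ, ‖F (m + Complex.I)‖ ^ p ≤
      2 ^ p * ((∫ x in Set.Ioc (m : ℝ) (m + 1), ‖F (x + Complex.I)‖ ^ p) +
        2 ^ p * (∑ n ∈ S, cauchyKernel (m - n) * r n) ^ p) := by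
    intro m
    have hpt2 : ∀ x ∈ Set.Ioo (m : ℝ) (m + 1), ‖F (m + Complex.I)‖ ^ p ≤
        2 ^ p * (‖F (x + Complex.I)‖ ^ p +
          2 ^ p * (∑ n ∈ S, cauchyKernel (m - n) * r n) ^ p) := by
      intro x hx
      have h1 := norm_cauchyTransform_sub_le S (fun n => (r n : ℂ)) hx
      have h2 : ∀ n, ‖(r n : ℂ)‖ = r n := fun n => by
        rw [Complex.norm_real, Real.norm_of_nonneg (hr n)]
      simp only [h2] at h1
      rw [← Real.mul_rpow zero_le_two (hconv0 m)]
      exact (Real.rpow_le_rpow (norm_nonneg _) h1 hp0.le).trans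
        (add_rpow_le (norm_nonneg _) (mul_nonneg zero_le_two (hconv0 m)) hp0.le)
    have h3 : ‖F (m + Complex.I)‖ ^ p =
        ∫ x in Set.Ioo (m : ℝ) (m + 1), ‖F (m + Complex.I)‖ ^ p := by simp
    rw [h3]
    refine (setIntegral_mono_on (by simp) ?_ measurableSet_Ioo hpt2).trans (le_of_eq ?_)
    · exact ((hFi.integrableOn).add (integrable_const _)).const_mul _
    · rw [integral_const_mul, integral_add hFi.integrableOn (integrable_const _),
        integral_Ioc_eq_integral_Ioo]
      simp
  calc ∑ m ∈ M, ‖F (m + Complex.I)‖ ^ p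
      ≤ ∑ m ∈ M, 2 ^ p * ((∫ x in Set.Ioc (m : ℝ) (m + 1), ‖F (x + Complex.I)‖ ^ p) +
        2 ^ p * (∑ n ∈ S, cauchyKernel (m - n) * r n) ^ p) := Finset.sum_le_sum fun m _ => hcell m
    _ = 2 ^ p * ((∑ m ∈ M, ∫ x in Set.Ioc (m : ℝ) (m + 1), ‖F (x + Complex.I)‖ ^ p) +
        2 ^ p * ∑ m ∈ M, (∑ n ∈ S, cauchyKernel (m - n) * r n) ^ p) := by
        rw [← Finset.mul_sum, Finset.sum_add_distrib, ← Finset.mul_sum]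
    _ ≤ 2 ^ p * (A * (4 ^ p * kernelSum ^ p * ∑ n ∈ S, r n ^ p) +
        2 ^ p * (kernelSum ^ p * ∑ n ∈ S, r n ^ p)) := by
        gcongr
        · exact (sum_cell_integral_le hFi (fun x => by positivity) M).trans
            (hint1.trans (by gcongr))
        · exact hY M
    _ = _ := by ring

/-- The Cauchy transform, sampled on `ℤ + i`, is bounded on `ℓ^p`. -/
def RieszBound (p : ℝ) : Prop :=
  ∃ C : ℝ, 0 ≤ C ∧ ∀ (S M : Finset ℤ) (d : ℤ → ℂ),
    ∑ m ∈ M, ‖cauchyTransform S d (m + Complex.I)‖ ^ p ≤ C * ∑ n ∈ S, ‖d n‖ ^ p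

theorem sum_norm_add_rpow_le {p C X₁ X₂ Y : ℝ} (hp : 0 ≤ p) (hC : 0 ≤ C) (M : Finset ℤ)
    {f g h : ℤ → ℂ} (hfgh : ∀ m, ‖f m‖ ≤ ‖g m‖ + ‖h m‖)
    (hg : ∑ m ∈ M, ‖g m‖ ^ p ≤ C * X₁) (hh : ∑ m ∈ M, ‖h m‖ ^ p ≤ C * X₂) (hX₁ : X₁ ≤ Y)
    (hX₂ : X₂ ≤ Y) :
    ∑ m ∈ M, ‖f m‖ ^ p ≤ 2 ^ p * (2 * C) * Y := by
  calc ∑ m ∈ M, ‖f m‖ ^ p ≤ ∑ m ∈ M, 2 ^ p * (‖g m‖ ^ p + ‖h m‖ ^ p) :=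
        Finset.sum_le_sum fun m _ => (Real.rpow_le_rpow (norm_nonneg _) (hfgh m) hp).trans
          (add_rpow_le (norm_nonneg _) (norm_nonneg _) hp)
    _ = 2 ^ p * (∑ m ∈ M, ‖g m‖ ^ p + ∑ m ∈ M, ‖h m‖ ^ p) := by
        rw [← Finset.mul_sum, Finset.sum_add_distrib]
    _ ≤ 2 ^ p * (C * Y + C * Y) := by
        gcongr
        · exact hg.trans (by gcongr)
        · exact hh.trans (by gcongr)
    _ = _ := by ring

/-- Reduction to nonnegative sequences: split `d` into real and imaginary, then positive and
negative parts. -/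
theorem rieszBound_of_le_two {p : ℝ} (hp : 1 < p) (hp2 : p ≤ 2) : RieszBound p := by
  have hp0 : 0 < p := by linarith
  obtain ⟨C, hC, h⟩ := exists_sum_cauchyTransform_le_of_nonneg hp hp2
  have hreal : ∀ (S M : Finset ℤ) (r : ℤ → ℝ),
      ∑ m ∈ M, ‖cauchyTransform S (fun n => (r n : ℂ)) (m + Complex.I)‖ ^ p ≤
        2 ^ p * (2 * C) * ∑ n ∈ S, |r n| ^ p := by
    intro S M r
    refine sum_norm_add_rpow_le hp0.le hC M (fun m => ?_)
      (h S M (fun n => max (r n) 0) fun n => le_max_right _ _)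
      (h S M (fun n => max (-r n) 0) fun n => le_max_right _ _)
      (Finset.sum_le_sum fun n _ => ?_) (Finset.sum_le_sum fun n _ => ?_)
    · have : cauchyTransform S (fun n => (r n : ℂ)) (m + Complex.I) =
          cauchyTransform S (fun n => ((max (r n) 0 : ℝ) : ℂ)) (m + Complex.I) -
          cauchyTransform S (fun n => ((max (-r n) 0 : ℝ) : ℂ)) (m + Complex.I) := by
        rw [cauchyTransform, cauchyTransform, cauchyTransform, ← Finset.sum_sub_distrib]
        refine Finset.sum_congr rfl fun n _ => ?_
        rw [← sub_div, ← Complex.ofReal_sub, max_zero_sub_max_neg_zero_eq_self]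
      rw [this]
      exact norm_sub_le _ _
    · exact Real.rpow_le_rpow (le_max_right _ _) (max_le (le_abs_self _) (abs_nonneg _)) hp0.le
    · exact Real.rpow_le_rpow (le_max_right _ _) (max_le (neg_le_abs _) (abs_nonneg _)) hp0.le
  refine ⟨2 ^ p * (2 * (2 ^ p * (2 * C))), by positivity, fun S M d => ?_⟩
  refine sum_norm_add_rpow_le hp0.le (by positivity) M (fun m => ?_)
    (hreal S M fun n => (d n).re) (hreal S M fun n => (d n).im)
    (Finset.sum_le_sum fun n _ => ?_) (Finset.sum_le_sum fun n _ => ?_)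
  · have : cauchyTransform S d (m + Complex.I) =
        cauchyTransform S (fun n => ((d n).re : ℂ)) (m + Complex.I) +
        Complex.I * cauchyTransform S (fun n => ((d n).im : ℂ)) (m + Complex.I) := by
      rw [cauchyTransform, cauchyTransform, cauchyTransform, Finset.mul_sum,
        ← Finset.sum_add_distrib]
      refine Finset.sum_congr rfl fun n _ => ?_
      rw [← mul_div_assoc, ← add_div, mul_comm Complex.I, Complex.re_add_im]
    rw [this]
    refine (norm_add_le _ _).trans (le_of_eq ?_)
    rw [norm_mul, Complex.norm_I, one_mul]
  · exact Real.rpow_le_rpow (abs_nonneg _) (Complex.abs_re_le_norm _) hp0.le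
  · exact Real.rpow_le_rpow (abs_nonneg _) (Complex.abs_im_le_norm _) hp0.le

/-- The transposed kernel `1 / (m + i - n)` is minus the complex conjugate of `1 / (n + i - m)`. -/
theorem norm_sum_div_conj (M : Finset ℤ) (e : ℤ → ℂ) (n : ℤ) :
    ‖∑ m ∈ M, e m / ((m : ℂ) + Complex.I - n)‖ =
      ‖cauchyTransform M (fun m => (starRingEnd ℂ) (e m)) (n + Complex.I)‖ := by
  rw [← Complex.norm_conj, ← norm_neg, map_sum, ← Finset.sum_neg_distrib, cauchyTransform]
  congr 1
  refine Finset.sum_congr rfl fun m _ => ?_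
  rw [map_div₀, ← div_neg]
  congr 1
  simp
  ring

/-- The transpose of the Cauchy transform is, up to conjugation, the Cauchy transform itself, so
boundedness passes to the conjugate exponent. -/
theorem RieszBound.dual {p q : ℝ} (hpq : p.HolderConjugate q) (h : RieszBound p) :
    RieszBound q := by
  obtain ⟨C, hC, h⟩ := h
  have hp0 := hpq.pos
  have hq0 := hpq.symm.pos
  refine ⟨(C ^ (1 / p)) ^ q, by positivity, fun S M d => ?_⟩
  set v : ℤ → ℂ := fun m => cauchyTransform S d (m + Complex.I) with hv
  set X := ∑ m ∈ M, ‖v m‖ ^ q with hX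
  have hX0 : 0 ≤ X := by positivity
  rcases hX0.eq_or_lt with hX0' | hXpos
  · rw [← hX0']; positivity
  -- the extremal sequence in Hölder's inequality for `v`
  set e : ℤ → ℂ := fun m => ((‖v m‖ ^ (q - 2) : ℝ) : ℂ) * (starRingEnd ℂ) (v m) with he
  have hev : ∀ m, e m * v m = ((‖v m‖ ^ q : ℝ) : ℂ) := by
    intro m
    by_cases hm : v m = 0
    · simp [hm, Real.zero_rpow hq0.ne']
    · have hm' : 0 < ‖v m‖ := norm_pos_iff.2 hm
      rw [he, mul_assoc, mul_comm ((starRingEnd ℂ) (v m)), Complex.mul_conj, ← Complex.ofReal_mul,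
        Complex.normSq_eq_norm_sq, ← Real.rpow_natCast, ← Real.rpow_add hm']
      norm_num
  have hen : ∀ m, ‖e m‖ ^ p = ‖v m‖ ^ q := by
    intro m
    by_cases hm : v m = 0
    · simp [he, hm, Real.zero_rpow hq0.ne', Real.zero_rpow hp0.ne']
    · have hm' : 0 < ‖v m‖ := norm_pos_iff.2 hm
      have h1 : ‖e m‖ = ‖v m‖ ^ (q - 1) := by
        simp only [he, norm_mul, Complex.norm_real, RCLike.norm_conj]
        rw [Real.norm_of_nonneg (by positivity)]
        nth_rewrite 2 [← Real.rpow_one ‖v m‖]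
        rw [← Real.rpow_add hm']
        congr 1; ring
      rw [h1, ← Real.rpow_mul hm'.le]
      congr 1
      exact hpq.symm.sub_one_mul_conj
  have hsum : (X : ℂ) = ∑ n ∈ S, d n * ∑ m ∈ M, e m / ((m : ℂ) + Complex.I - n) := by
    rw [hX]
    push_cast
    have : ∀ m ∈ M, ((‖v m‖ ^ q : ℝ) : ℂ) = ∑ n ∈ S, d n * (e m / ((m : ℂ) + Complex.I - n)) := by
      intro m _
      rw [← hev, hv]
      simp only [cauchyTransform, Finset.mul_sum]
      exact Finset.sum_congr rfl fun n _ => by ring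
    rw [Finset.sum_congr rfl this, Finset.sum_comm]
    simp only [Finset.mul_sum]
  set w : ℤ → ℝ := fun n =>
    ‖cauchyTransform M (fun m => (starRingEnd ℂ) (e m)) (n + Complex.I)‖ with hw
  have hle : X ≤ ∑ n ∈ S, w n * ‖d n‖ := by
    calc X = ‖(X : ℂ)‖ := by rw [Complex.norm_real, Real.norm_of_nonneg hX0]
      _ ≤ _ := by
        rw [hsum]
        refine (norm_sum_le _ _).trans (Finset.sum_le_sum fun n _ => ?_)
        rw [norm_mul, norm_sum_div_conj, mul_comm]
  have hhol := Real.inner_le_Lp_mul_Lq S w (fun n => ‖d n‖) hpq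
  simp only [hw, abs_norm] at hhol
  have hwb := h M S (fun m => (starRingEnd ℂ) (e m))
  simp only [RCLike.norm_conj, hen] at hwb
  set Y := ∑ n ∈ S, ‖d n‖ ^ q with hY
  have hY0 : 0 ≤ Y := by positivity
  have hmain : X ≤ C ^ (1 / p) * X ^ (1 / p) * Y ^ (1 / q) := by
    refine hle.trans (hhol.trans ?_)
    rw [← Real.mul_rpow hC hX0]
    gcongr
  have hdiv : X ^ (1 / q) ≤ C ^ (1 / p) * Y ^ (1 / q) := by
    have hXp : 0 < X ^ (1 / p) := Real.rpow_pos_of_pos hXpos _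
    have hsplit : X ^ (1 / p) * X ^ (1 / q) = X := by
      rw [← Real.rpow_add hXpos, one_div, one_div, hpq.inv_add_inv_eq_one, Real.rpow_one]
    refine le_of_mul_le_mul_left ?_ hXp
    rw [hsplit]
    linarith
  calc X = (X ^ (1 / q)) ^ q := by
        rw [← Real.rpow_mul hX0, one_div_mul_cancel hq0.ne', Real.rpow_one]
    _ ≤ (C ^ (1 / p) * Y ^ (1 / q)) ^ q := by gcongr
    _ = (C ^ (1 / p)) ^ q * Y := by
        rw [Real.mul_rpow (by positivity) (by positivity), ← Real.rpow_mul hY0,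
          one_div_mul_cancel hq0.ne', Real.rpow_one]

theorem rieszBound {p : ℝ} (hp : 1 < p) : RieszBound p := by
  rcases le_total p 2 with h | h
  · exact rieszBound_of_le_two hp h
  · have hpq := Real.HolderConjugate.conjExponent hp
    refine RieszBound.dual hpq.symm (rieszBound_of_le_two hpq.symm.lt ?_)
    rw [Real.conjExponent, div_le_iff₀ (by linarith)]
    linarith

/-! ### Cardinal series -/

/-- The entire function `sin (πz) / (πz)`, with value `1` at the origin. -/
def csinc (z : ℂ) : ℂ := dslope (fun z : ℂ => Complex.sin (Real.pi * z)) 0 z / Real.pi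

theorem pi_ne_zero_complex : (Real.pi : ℂ) ≠ 0 := by exact_mod_cast Real.pi_ne_zero

theorem differentiable_csinc : Differentiable ℂ csinc := by
  have h : Differentiable ℂ (dslope (fun z : ℂ => Complex.sin (Real.pi * z)) 0) := fun z =>
    ((Complex.differentiableOn_dslope (c := (0 : ℂ)) univ_mem).2
      (by fun_prop)).differentiableAt univ_mem
  exact h.div_const _

theorem csinc_zero : csinc 0 = 1 := by
  have h1 : HasDerivAt (fun z : ℂ => Complex.sin (Real.pi * z)) Real.pi 0 := by
    simpa using! ((hasDerivAt_id (0 : ℂ)).const_mul (Real.pi : ℂ)).csin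
  rw [csinc, dslope_same, h1.deriv, div_self pi_ne_zero_complex]

theorem csinc_of_ne {z : ℂ} (hz : z ≠ 0) : csinc z = Complex.sin (Real.pi * z) / (Real.pi * z) := by
  rw [csinc, dslope_of_ne _ hz, slope_def_field]
  simp
  field_simp

theorem csinc_int_sub_int (m n : ℤ) : csinc ((m : ℂ) - n) = if n = m then 1 else 0 := by
  split_ifs with h
  · rw [h, sub_self, csinc_zero]
  · have h0 : (m : ℂ) - n ≠ 0 := by
      rw [sub_ne_zero]; exact_mod_cast Ne.symm h
    rw [csinc_of_ne h0, ← Int.cast_sub, mul_comm, Complex.sin_int_mul_pi, zero_div]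

theorem exists_norm_csinc_le :
    ∃ B : ℝ, 0 ≤ B ∧ ∀ z, ‖csinc z‖ ≤ B * Real.exp (Real.pi * |z.im|) := by
  obtain ⟨B, hB⟩ := (isCompact_closedBall (0 : ℂ) 1).exists_bound_of_continuousOn
    differentiable_csinc.continuous.continuousOn
  have hpi := Real.pi_gt_three
  refine ⟨max B 1, by positivity, fun z => ?_⟩
  have h1 : 1 ≤ Real.exp (Real.pi * |z.im|) := Real.one_le_exp (by positivity)
  rcases le_total ‖z‖ 1 with h | h
  · calc ‖csinc z‖ ≤ max B 1 * 1 := by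
          rw [mul_one]; exact (hB z (by simpa using h)).trans (le_max_left _ _)
      _ ≤ _ := by gcongr
  · have hz : z ≠ 0 := by rw [← norm_pos_iff]; linarith
    rw [csinc_of_ne hz, norm_div, norm_mul, Complex.norm_real, Real.norm_of_nonneg Real.pi_pos.le,
      div_le_iff₀ (by positivity)]
    have h2 := norm_sin_le_exp (Real.pi * z)
    rw [Complex.im_ofReal_mul, abs_mul, abs_of_pos Real.pi_pos] at h2
    refine h2.trans ?_
    have h3 : (1 : ℝ) ≤ max B 1 := le_max_right _ _
    have h4 : 1 ≤ Real.pi * ‖z‖ := by nlinarith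
    nlinarith [mul_le_mul h3 h4 zero_le_one (by linarith)]

/-- The cardinal series of a finite sequence. -/
def sincSum (S : Finset ℤ) (c : ℤ → ℂ) (z : ℂ) : ℂ := ∑ n ∈ S, c n * csinc (z - n)

theorem differentiable_sincSum (S : Finset ℤ) (c : ℤ → ℂ) : Differentiable ℂ (sincSum S c) := by
  unfold sincSum
  refine Differentiable.fun_sum fun n _ => ?_
  exact (differentiable_const _).mul (differentiable_csinc.comp (by fun_prop))

theorem hasExpType_sincSum (S : Finset ℤ) (c : ℤ → ℂ) : HasExpType Real.pi (sincSum S c) := by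
  obtain ⟨B, hB0, hB⟩ := exists_norm_csinc_le
  refine hasExpType_of_norm_le (M := ∑ n ∈ S, ‖c n‖ * B) Real.pi_pos.le fun z => ?_
  rw [Finset.sum_mul]
  refine (norm_sum_le _ _).trans (Finset.sum_le_sum fun n _ => ?_)
  rw [norm_mul, mul_assoc]
  gcongr
  simpa using hB (z - n)

/-- On the cell `(m, m + 1)` the cardinal series is `sin (πt) / π` times a Cauchy transform, which
may be evaluated at `m + i` up to a convolution with a summable kernel. -/
theorem norm_sincSum_le (S : Finset ℤ) (c : ℤ → ℂ) {m : ℤ} {t : ℝ}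
    (ht : t ∈ Set.Ioo (m : ℝ) (m + 1)) :
    ‖sincSum S c t‖ ≤ ‖cauchyTransform S (fun n => (-1) ^ n * c n) (m + Complex.I)‖ +
      8 * ∑ n ∈ S, cauchyKernel (m - n) * ‖c n‖ := by
  have hpi := Real.pi_gt_three
  set a : ℂ := Complex.sin (Real.pi * t) / Real.pi with ha
  have ha1 : ‖a‖ ≤ 1 := by
    have h := norm_sin_le_exp (Real.pi * t)
    rw [ha, norm_div, Complex.norm_real, Real.norm_of_nonneg (by linarith),
      div_le_one (by linarith)]
    simp only [Complex.im_ofReal_mul, Complex.ofReal_im, mul_zero, abs_zero, Real.exp_zero] at h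
    linarith
  have key : ‖sincSum S c t - a * cauchyTransform S (fun n => (-1) ^ n * c n) (m + Complex.I)‖ ≤
      8 * ∑ n ∈ S, cauchyKernel (m - n) * ‖c n‖ := by
    rw [sincSum, cauchyTransform, Finset.mul_sum, Finset.mul_sum, ← Finset.sum_sub_distrib]
    refine (norm_sum_le _ _).trans (Finset.sum_le_sum fun n _ => ?_)
    have hs : t - n ≠ 0 := by
      intro h
      have h1 : t = n := by linarith
      rw [h1] at ht
      have h2 := ht.1
      have h3 := ht.2
      norm_cast at h2 h3
      omega
    set s : ℝ := t - n with hsdef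
    set w : ℂ := (m : ℂ) + Complex.I - n with hw
    have hw0 : w ≠ 0 := sub_int_ne_zero (by simp) n
    have hsc : (t : ℂ) - n = (s : ℂ) := by rw [hsdef]; push_cast; rfl
    have hs0 : (s : ℂ) ≠ 0 := by exact_mod_cast hs
    have hws : ‖w - s‖ ≤ 2 := by
      have h1 : w - s = ((m - t : ℝ) : ℂ) + Complex.I := by
        rw [hw, hsdef]; push_cast; ring
      rw [h1]
      refine (norm_add_le _ _).trans ?_
      rw [Complex.norm_real, Complex.norm_I, Real.norm_eq_abs]
      have : |(m : ℝ) - t| ≤ 1 := by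
        rw [abs_le]; constructor <;> linarith [ht.1, ht.2]
      linarith
    have hsin : (-1) ^ n * Complex.sin (Real.pi * t) = Complex.sin (Real.pi * s) := by
      have h1 : (Real.pi : ℂ) * s = Real.pi * t - n * Real.pi := by
        rw [hsdef]; push_cast; ring
      rw [h1, Complex.sin_antiperiodic.sub_int_mul_eq, Int.cast_negOnePow]
    have heq : c n * csinc (t - n) - a * ((-1) ^ n * c n / w) =
        c n * (Complex.sin (Real.pi * s) * (w - s) / (Real.pi * s * w)) := by
      rw [hsc, csinc_of_ne hs0, ha, ← hsin]
      field_simp [pi_ne_zero_complex]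
    have hsinb : ‖Complex.sin (Real.pi * s)‖ ≤ 1 ∧ ‖Complex.sin (Real.pi * s)‖ ≤ Real.pi * |s| := by
      rw [← Complex.ofReal_mul, ← Complex.ofReal_sin, Complex.norm_real, Real.norm_eq_abs]
      refine ⟨Real.abs_sin_le_one _, ?_⟩
      refine Real.abs_sin_le_abs.trans ?_
      rw [abs_mul, abs_of_pos Real.pi_pos]
    have hk : cauchyKernel (m - n) = (‖w‖ ^ 2)⁻¹ := by
      rw [hw, norm_int_add_I_sub_sq, inv_inv]
    have hwn : 0 < ‖w‖ := norm_pos_iff.2 hw0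
    have hsn : 0 < |s| := abs_pos.2 hs
    have hwle : ‖w‖ ≤ 2 + |s| := by
      calc ‖w‖ = ‖(w - s) + s‖ := by ring_nf
        _ ≤ _ := (norm_add_le _ _).trans (by
          rw [Complex.norm_real, Real.norm_eq_abs]; gcongr)
    -- by `‖w‖ ≤ 2 + |s|`, using `|sin πs| ≤ π |s|` for the term `2` and `|sin πs| ≤ 1` for `|s|`
    have hfin : ‖Complex.sin (Real.pi * s)‖ * ‖w‖ ≤ 4 * (Real.pi * |s|) := by
      set y := ‖Complex.sin (Real.pi * s)‖
      have hy0 : 0 ≤ y := norm_nonneg _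
      nlinarith [hsinb.1, hsinb.2]
    rw [heq, hk, norm_mul, norm_div, norm_mul, norm_mul, norm_mul, Complex.norm_real,
      Complex.norm_real, Real.norm_of_nonneg Real.pi_pos.le, Real.norm_eq_abs]
    have : ‖Complex.sin (Real.pi * s)‖ * ‖w - s‖ / (Real.pi * |s| * ‖w‖) ≤ 8 * (‖w‖ ^ 2)⁻¹ := by
      rw [← div_eq_mul_inv, div_le_div_iff₀ (by positivity) (by positivity)]
      calc _ ≤ ‖Complex.sin (Real.pi * s)‖ * 2 * ‖w‖ ^ 2 := by gcongr
        _ = 2 * ‖w‖ * (‖Complex.sin (Real.pi * s)‖ * ‖w‖) := by ring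
        _ ≤ 2 * ‖w‖ * (4 * (Real.pi * |s|)) := by gcongr
        _ = _ := by ring
    calc _ ≤ ‖c n‖ * (8 * (‖w‖ ^ 2)⁻¹) := by gcongr
      _ = _ := by ring
  have h1 := norm_sub_norm_le (sincSum S c t)
    (a * cauchyTransform S (fun n => (-1) ^ n * c n) (m + Complex.I))
  have h2 : ‖a * cauchyTransform S (fun n => (-1) ^ n * c n) (m + Complex.I)‖ ≤
      ‖cauchyTransform S (fun n => (-1) ^ n * c n) (m + Complex.I)‖ := by
    rw [norm_mul]
    exact mul_le_of_le_one_left (norm_nonneg _) ha1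
  linarith

/-- The `L^p` bound for cardinal series. On each cell the series is bounded by the Cauchy
transform of the sequence `(-1)^n c_n` at `m + i`, up to an error controlled by Young's inequality. -/
theorem exists_lintegral_sincSum_le {p : ℝ} (hp : 1 < p) :
    ∃ C : ℝ, 0 ≤ C ∧ ∀ (S : Finset ℤ) (c : ℤ → ℂ),
      ∫⁻ t : ℝ, ‖sincSum S c t‖ₑ ^ p ≤ ENNReal.ofReal (C * ∑ n ∈ S, ‖c n‖ ^ p) := by
  have hp0 : 0 < p := by linarith
  have hK := kernelSum_pos
  obtain ⟨C, hC0, hC⟩ := rieszBound hp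
  refine ⟨2 ^ p * (C + 8 ^ p * kernelSum ^ p), by positivity, fun S c => ?_⟩
  have hconv0 : ∀ m : ℤ, 0 ≤ ∑ n ∈ S, cauchyKernel (m - n) * ‖c n‖ := fun m =>
    Finset.sum_nonneg fun n _ => mul_nonneg (cauchyKernel_pos _).le (norm_nonneg _)
  refine lintegral_le_of_cells (b := fun m => 2 ^ p *
    (‖cauchyTransform S (fun n => (-1) ^ n * c n) (m + Complex.I)‖ ^ p +
      8 ^ p * (∑ n ∈ S, cauchyKernel (m - n) * ‖c n‖) ^ p))
    (fun m => ?_) (fun m t ht => ?_) (fun M => ?_)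
  · have := Real.rpow_nonneg (hconv0 m) p
    positivity
  · rw [← ofReal_norm, ENNReal.ofReal_rpow_of_nonneg (norm_nonneg _) hp0.le,
      ← Real.mul_rpow (by norm_num) (hconv0 m)]
    refine ENNReal.ofReal_le_ofReal ?_
    exact (Real.rpow_le_rpow (norm_nonneg _) (norm_sincSum_le S c ht) hp0.le).trans
      (add_rpow_le (norm_nonneg _) (mul_nonneg (by norm_num) (hconv0 m)) hp0.le)
  · rw [← Finset.mul_sum, Finset.sum_add_distrib, ← Finset.mul_sum, mul_assoc]
    have h1 := hC S M (fun n => (-1) ^ n * c n)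
    simp only [norm_mul, norm_zpow, norm_neg, norm_one, one_zpow, one_mul] at h1
    have h2 := sum_conv_rpow_le hp.le S M (fun n => ‖c n‖) fun n => norm_nonneg _
    gcongr
    calc _ ≤ C * ∑ n ∈ S, ‖c n‖ ^ p + 8 ^ p * (kernelSum ^ p * ∑ n ∈ S, ‖c n‖ ^ p) := by gcongr
      _ = _ := by ring

theorem exists_eLpNorm_sincSum_le {p : ℝ≥0∞} (hp : 1 < p) (hp' : p < ∞) :
    ∃ C : ℝ, 0 ≤ C ∧ ∀ (S : Finset ℤ) (c : ℤ → ℂ),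
      eLpNorm (fun t : ℝ => sincSum S c t) p volume ≤
        ENNReal.ofReal (C * (∑ n ∈ S, ‖c n‖ ^ p.toReal) ^ (1 / p.toReal)) := by
  have hr : 1 < p.toReal := by
    rw [← ENNReal.toReal_one]
    exact (ENNReal.toReal_lt_toReal ENNReal.one_ne_top hp'.ne).2 hp
  obtain ⟨C, hC0, hC⟩ := exists_lintegral_sincSum_le hr
  refine ⟨C ^ (1 / p.toReal), by positivity, fun S c => ?_⟩
  rw [eLpNorm_eq_lintegral_rpow_enorm_toReal (by positivity) hp'.ne,
    ← Real.mul_rpow hC0 (by positivity), ← ENNReal.ofReal_rpow_of_nonneg (by positivity)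
      (by positivity)]
  exact ENNReal.rpow_le_rpow (hC S c) (by positivity)

theorem sincSum_mem_bernsteinSpace {p : ℝ≥0∞} (hp : 1 < p) (hp' : p < ∞) (S : Finset ℤ)
    (c : ℤ → ℂ) : sincSum S c ∈ bernsteinSpace Real.pi p := by
  obtain ⟨C, hC0, hC⟩ := exists_eLpNorm_sincSum_le hp hp'
  refine ⟨differentiable_sincSum S c, hasExpType_sincSum S c, ?_,
    (hC S c).trans_lt ENNReal.ofReal_lt_top⟩
  exact ((differentiable_sincSum S c).continuous.comp
    Complex.continuous_ofReal).aestronglyMeasurable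

/-- The pointwise bound makes cardinal series of an `ℓ^p` sequence converge locally uniformly. -/
theorem exists_norm_sincSum_le {p : ℝ≥0∞} (hp : 1 < p) (hp' : p < ∞) :
    ∃ D : ℝ, 0 < D ∧ ∀ (S : Finset ℤ) (c : ℤ → ℂ) (z : ℂ), ‖sincSum S c z‖ ≤
      D * (∑ n ∈ S, ‖c n‖ ^ p.toReal) ^ (1 / p.toReal) * Real.exp (Real.pi * |z.im|) := by
  obtain ⟨C, hC0, hC⟩ := exists_eLpNorm_sincSum_le hp hp'
  refine ⟨(1 + Real.exp Real.pi) * (C + 1), by positivity, fun S c z => ?_⟩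
  refine (norm_le_of_mem_bernsteinSpace Real.pi_pos.le hp.le
    (sincSum_mem_bernsteinSpace hp hp' S c) z).trans ?_
  have h1 : (eLpNorm (fun t : ℝ => sincSum S c t) p volume).toReal ≤
      C * (∑ n ∈ S, ‖c n‖ ^ p.toReal) ^ (1 / p.toReal) :=
    ENNReal.toReal_le_of_le_ofReal (by positivity) (hC S c)
  have h2 : 0 ≤ (∑ n ∈ S, ‖c n‖ ^ p.toReal) ^ (1 / p.toReal) := by positivity
  refine mul_le_mul_of_nonneg_right ?_ (Real.exp_pos _).le
  rw [mul_assoc]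
  gcongr
  exact h1.trans (mul_le_mul_of_nonneg_right (by linarith) h2)

/-- Every `ℓ^p` sequence with `1 < p < ∞` is the restriction to the integers of a function in the
Bernstein space of type `π`, the sum of its cardinal series. -/
theorem exists_interpolation_int {p : ℝ≥0∞} (hp : 1 < p) (hp' : p < ∞) (c : ℤ → ℂ)
    (hc : Summable fun n => ‖c n‖ ^ p.toReal) :
    ∃ f ∈ bernsteinSpace Real.pi p, ∀ n : ℤ, f n = c n := by
  have hr : 0 < p.toReal := ENNReal.toReal_pos (by positivity) hp'.ne
  obtain ⟨D, hD0, hD⟩ := exists_norm_sincSum_le hp hp'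
  obtain ⟨C, hC0, hC⟩ := exists_eLpNorm_sincSum_le hp hp'
  set N := ∑' n, ‖c n‖ ^ p.toReal with hN
  have hNle : ∀ S : Finset ℤ, ∑ n ∈ S, ‖c n‖ ^ p.toReal ≤ N := fun S =>
    hc.sum_le_tsum S fun n _ => by positivity
  -- tails of the cardinal series are small, uniformly on horizontal strips
  have hvanish : ∀ ε > 0, ∃ s : Finset ℤ, ∀ t, Disjoint t s → ∀ z : ℂ,
      ‖sincSum t c z‖ ≤ ε * Real.exp (Real.pi * |z.im|) := by
    intro ε hε
    obtain ⟨s, hs⟩ := summable_iff_vanishing_norm.1 hc ((ε / D) ^ p.toReal) (by positivity)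
    refine ⟨s, fun t ht z => (hD t c z).trans ?_⟩
    have h1 := hs t ht
    rw [Real.norm_of_nonneg (by positivity)] at h1
    gcongr
    calc D * (∑ n ∈ t, ‖c n‖ ^ p.toReal) ^ (1 / p.toReal)
        ≤ D * ((ε / D) ^ p.toReal) ^ (1 / p.toReal) := by gcongr
      _ = ε := by
        rw [← Real.rpow_mul (by positivity), mul_one_div_cancel hr.ne', Real.rpow_one]
        field_simp
  have hsum : ∀ z : ℂ, Summable fun n : ℤ => c n * csinc (z - n) := by
    intro z
    rw [summable_iff_vanishing_norm]
    intro ε hε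
    obtain ⟨s, hs⟩ := hvanish (ε / 2 / Real.exp (Real.pi * |z.im|)) (by positivity)
    refine ⟨s, fun t ht => (hs t ht z).trans_lt ?_⟩
    rw [div_mul_cancel₀ _ (Real.exp_pos _).ne']
    linarith
  set f : ℂ → ℂ := fun z => ∑' n : ℤ, c n * csinc (z - n) with hf
  have hlim : ∀ z, Tendsto (fun S => sincSum S c z) atTop (nhds (f z)) := fun z => (hsum z).hasSum
  have hunif : ∀ ε > 0, ∃ s : Finset ℤ, ∀ S, s ⊆ S → ∀ z : ℂ,
      ‖f z - sincSum S c z‖ ≤ ε * Real.exp (Real.pi * |z.im|) := by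
    intro ε hε
    obtain ⟨s, hs⟩ := hvanish ε hε
    refine ⟨s, fun S hS z => ?_⟩
    refine le_of_tendsto ((hlim z).sub_const (sincSum S c z)).norm ?_
    filter_upwards [eventually_ge_atTop S] with S' hS'
    have h1 : sincSum S' c z - sincSum S c z = sincSum (S' \ S) c z := by
      rw [sub_eq_iff_eq_add]
      exact (Finset.sum_sdiff hS').symm
    rw [h1]
    exact hs _ (Finset.sdiff_disjoint.mono_right hS) z
  have hfd : Differentiable ℂ f := by
    rw [← differentiableOn_univ]
    refine TendstoLocallyUniformlyOn.differentiableOn (F := fun S z => sincSum S c z)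
      (φ := (atTop : Filter (Finset ℤ))) ?_
      (Eventually.of_forall fun S => (differentiable_sincSum S c).differentiableOn) isOpen_univ
    rw [Metric.tendstoLocallyUniformlyOn_iff]
    intro ε hε z _
    obtain ⟨s, hs⟩ := hunif (ε / 2 / Real.exp (Real.pi * (|z.im| + 1))) (by positivity)
    refine ⟨Metric.ball z 1, mem_nhdsWithin_of_mem_nhds (Metric.ball_mem_nhds z one_pos), ?_⟩
    filter_upwards [eventually_ge_atTop s] with S hS w hw
    rw [dist_eq_norm]
    have him : |w.im| ≤ |z.im| + 1 := by
      have h1 := Complex.abs_im_le_norm (w - z)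
      rw [Metric.mem_ball, dist_eq_norm] at hw
      rw [Complex.sub_im] at h1
      have h2 := abs_sub_abs_le_abs_sub w.im z.im
      linarith
    calc _ ≤ ε / 2 / Real.exp (Real.pi * (|z.im| + 1)) * Real.exp (Real.pi * |w.im|) := hs S hS w
      _ ≤ ε / 2 / Real.exp (Real.pi * (|z.im| + 1)) * Real.exp (Real.pi * (|z.im| + 1)) := by
        have := Real.pi_pos
        gcongr
      _ = ε / 2 := div_mul_cancel₀ _ (Real.exp_pos _).ne'
      _ < ε := by linarith
  have hfe : HasExpType Real.pi f := by
    refine hasExpType_of_norm_le (M := D * N ^ (1 / p.toReal)) Real.pi_pos.le fun z => ?_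
    refine le_of_tendsto (hlim z).norm (Eventually.of_forall fun S => (hD S c z).trans ?_)
    gcongr
    exact hNle S
  refine ⟨f, ⟨hfd, hfe, ?_, ?_⟩, fun m => ?_⟩
  · exact (hfd.continuous.comp Complex.continuous_ofReal).aestronglyMeasurable
  -- Fatou along a sequence of partial sums, whose `L^p` norms are bounded
  · obtain ⟨S, hS⟩ := exists_seq_tendsto (atTop : Filter (Finset ℤ))
    have hle : ∀ k, eLpNorm (fun t : ℝ => sincSum (S k) c t) p volume ≤
        ENNReal.ofReal (C * N ^ (1 / p.toReal)) := fun k => by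
      refine (hC (S k) c).trans (ENNReal.ofReal_le_ofReal ?_)
      gcongr
      exact hNle _
    refine (Lp.eLpNorm_lim_le_liminf_eLpNorm (f := fun k (t : ℝ) => sincSum (S k) c t)
      (fun k => ((differentiable_sincSum (S k) c).continuous.comp
        Complex.continuous_ofReal).aestronglyMeasurable) (fun t : ℝ => f t)
      (Eventually.of_forall fun t => (hlim t).comp hS)).trans_lt ?_
    refine lt_of_le_of_lt ?_ (ENNReal.ofReal_lt_top (r := C * N ^ (1 / p.toReal)))
    exact (liminf_le_liminf (Eventually.of_forall hle)).trans (by simp)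
  · simp only [hf, csinc_int_sub_int]
    simp

/-! ### Rescaling and complete interpolation -/

theorem comp_mul_mem_bernsteinSpace {f : ℂ → ℂ} {σ a : ℝ} {p : ℝ≥0∞} (ha : 0 < a)
    (hf : f ∈ bernsteinSpace σ p) : (fun z => f (z * a)) ∈ bernsteinSpace (σ * a) p := by
  obtain ⟨hd, he, hL⟩ := hf
  refine ⟨hd.comp (by fun_prop), fun ε hε => ?_, ?_⟩
  · obtain ⟨C, hC⟩ := he (ε / a) (by positivity)
    refine ⟨C, fun z => (hC _).trans (le_of_eq ?_)⟩
    rw [norm_mul, Complex.norm_real, Real.norm_of_nonneg ha.le]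
    congr 2
    field_simp
  · have hmap := Real.map_volume_mul_right ha.ne'
    have h1 : MemLp (fun t : ℝ => f t) p (Measure.map (· * a) volume) := by
      rw [hmap]
      exact hL.smul_measure ENNReal.ofReal_ne_top
    have h2 := (memLp_map_measure_iff h1.1 (by fun_prop)).1 h1
    refine h2.congr_norm ?_ (Eventually.of_forall fun t => by simp)
    exact ((hd.continuous.comp (g := f) (f := fun t : ℝ => (t : ℂ) * a)
      (by fun_prop))).aestronglyMeasurable

theorem sub_mem_bernsteinSpace {f g : ℂ → ℂ} {σ : ℝ} {p : ℝ≥0∞} (hf : f ∈ bernsteinSpace σ p)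
    (hg : g ∈ bernsteinSpace σ p) : (fun z => f z - g z) ∈ bernsteinSpace σ p := by
  refine ⟨hf.1.sub hg.1, ?_, hf.2.2.sub hg.2.2⟩
  convert! hf.2.1.add (hg.2.1.const_mul (-1)) using 1
  ext z
  simp [sub_eq_add_neg]

theorem const_mul_mem_bernsteinSpace {f : ℂ → ℂ} {σ : ℝ} {p : ℝ≥0∞} (c : ℂ)
    (hf : f ∈ bernsteinSpace σ p) : (fun z => c * f z) ∈ bernsteinSpace σ p :=
  ⟨hf.1.const_mul c, hf.2.1.const_mul c, hf.2.2.const_mul c⟩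

/-- A function in a Bernstein space with `p < ∞` that vanishes at the Nyquist points is zero: it is
a multiple of a sine, which is not in `L^p`. -/
theorem eq_zero_of_vanishing {f : ℂ → ℂ} {σ β : ℝ} {p : ℝ≥0∞} (hp : 1 ≤ p) (hp' : p < ∞)
    (hβ : 0 < β) (hσ : σ * β = Real.pi) (hf : f ∈ bernsteinSpace σ p)
    (h0 : ∀ n : ℤ, f (n * β) = 0) (z : ℂ) : f z = 0 := by
  have hg := comp_mul_mem_bernsteinSpace hβ hf
  rw [hσ] at hg
  obtain ⟨c, hc⟩ := eq_const_mul_sin_of_forall_int hg.1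
    (norm_le_of_mem_bernsteinSpace Real.pi_pos.le hp hg) h0
  have hc0 : c = 0 := by
    by_contra hc0
    refine not_samples_bounded_below Real.pi_pos.le hp hp'.ne hg one_pos (norm_pos_iff.2 hc0)
      (1 / 2) fun n => ?_
    rw [hc, norm_mul]
    refine le_mul_of_one_le_right (norm_nonneg _) ?_
    have h1 := norm_sin_sq (Real.pi * (((1 / 2 : ℝ) : ℂ) + n * (1 : ℝ)))
    have h2 : ((Real.pi : ℂ) * (((1 / 2 : ℝ) : ℂ) + n * (1 : ℝ))) =
        ((Real.pi / 2 + n * Real.pi : ℝ) : ℂ) := by push_cast; ring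
    rw [h2, Complex.ofReal_re, Complex.ofReal_im, Real.sinh_zero] at h1
    have h3 : Real.sin (Real.pi / 2 + n * Real.pi) ^ 2 = 1 := by
      rw [Real.sin_add_int_mul_pi, mul_pow, Real.sin_pi_div_two, one_pow, mul_one, ← zpow_natCast,
        ← zpow_mul]
      push_cast
      rw [mul_comm, zpow_mul]
      norm_num
    rw [h2]
    rw [h3] at h1
    nlinarith [norm_nonneg (Complex.sin ((Real.pi / 2 + n * Real.pi : ℝ) : ℂ))]
  have h1 := hc (z / β)
  rw [hc0, zero_mul] at h1
  have hβ' : (β : ℂ) ≠ 0 := by exact_mod_cast hβ.ne'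
  simpa [div_mul_cancel₀ _ hβ'] using h1

/-- At the critical spacing `β = π / σ` the lattice `βℤ` is complete interpolating: rescale to the
integers, with existence from cardinal series and uniqueness from `eq_zero_of_vanishing`. -/
theorem isCompleteInterpolating_range {σ β : ℝ} {p : ℝ≥0∞} (hp : 1 < p) (hp' : p < ∞)
    (hβ : 0 < β) (hσ : σ * β = Real.pi) :
    IsCompleteInterpolating σ p (Set.range fun n : ℤ => (n : ℂ) * β) := by
  intro c hc
  have hr : 0 < p.toReal := ENNReal.toReal_pos (by positivity) hp'.ne
  have hβ' : (β : ℂ) ≠ 0 := by exact_mod_cast hβ.ne'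
  set pt : ℤ → Set.range (fun n : ℤ => (n : ℂ) * β) := fun n => ⟨(n : ℂ) * β, n, rfl⟩ with hpt
  have hinj : Function.Injective pt := by
    intro m n hmn
    have h1 : (m : ℂ) * β = n * β := congrArg Subtype.val hmn
    exact_mod_cast mul_right_cancel₀ hβ' h1
  have hsum : Summable fun n => ‖c (pt n)‖ ^ p.toReal :=
    ((memℓp_gen_iff hr).1 hc).comp_injective hinj
  obtain ⟨g, hg, hgc⟩ := exists_interpolation_int hp hp' (fun n => c (pt n)) hsum
  have hg' := comp_mul_mem_bernsteinSpace (inv_pos.2 hβ) hg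
  have hσ' : Real.pi * β⁻¹ = σ := by rw [← hσ]; field_simp
  rw [hσ'] at hg'
  have hval : ∀ z : Set.range (fun n : ℤ => (n : ℂ) * β), g ((z : ℂ) * (β⁻¹ : ℝ)) = c z := by
    rintro ⟨_, n, rfl⟩
    rw [← hgc n]
    congr 1
    push_cast
    field_simp
  refine ⟨_, ⟨hg', hval⟩, ?_⟩
  rintro f ⟨hf, hfc⟩
  ext z
  refine sub_eq_zero.1 (eq_zero_of_vanishing hp.le hp' hβ hσ (sub_mem_bernsteinSpace hf hg')
    (fun n => ?_) z)
  rw [sub_eq_zero, hfc (pt n)]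
  exact (hval (pt n)).symm

/-! ### Fourier–Laplace transforms -/

theorem angularFourier_surjective : Function.Surjective angularFourier := by
  intro ψ
  set e := ContinuousLinearEquiv.unitsEquivAut ℝ
      (Units.mk0 ((2 * Real.pi)⁻¹ : ℝ) (inv_ne_zero Real.two_pi_pos.ne')) with he
  refine ⟨𝓕⁻ (SchwartzMap.compCLMOfContinuousLinearEquiv ℂ e.symm ψ), ?_⟩
  ext t
  rw [angularFourier, FourierTransform.fourier_fourierInv_eq]
  change ψ (e.symm (e t)) = ψ t
  rw [e.symm_apply_apply]

/-- Testing against smooth compactly supported functions identifies the two transforms on `ℝ`; the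
identity theorem extends this to `ℂ`. -/
theorem IsFourierLaplace.unique {x : 𝓢'(ℝ, ℂ)} {f g : ℂ → ℂ} (hf : IsFourierLaplace x f)
    (hg : IsFourierLaplace x g) : f = g := by
  have hcf : Continuous fun t : ℝ => f t := hf.1.continuous.comp Complex.continuous_ofReal
  have hcg : Continuous fun t : ℝ => g t := hg.1.continuous.comp Complex.continuous_ofReal
  have hae : (fun t : ℝ => f t) =ᵐ[volume] fun t : ℝ => g t := by
    refine ae_eq_of_integral_contDiff_smul_eq hcf.locallyIntegrable hcg.locallyIntegrable
      fun φ hφ hφc => ?_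
    have hc : HasCompactSupport fun t : ℝ => (φ t : ℂ) :=
      hφc.comp_left (g := Complex.ofReal) Complex.ofReal_zero
    set ψ : 𝓢(ℝ, ℂ) := hc.toSchwartzMap (Complex.ofRealCLM.contDiff.comp hφ) with hψ
    have h1 := (hf.2 ψ).2.symm.trans (hg.2 ψ).2
    have h2 : ∀ t, ψ t = (φ t : ℂ) := fun t => rfl
    simp only [h2] at h1
    simpa only [Complex.real_smul, mul_comm] using h1
  have heq : (fun t : ℝ => f t) = fun t : ℝ => g t :=
    Continuous.ae_eq_iff_eq volume hcf hcg |>.1 hae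
  have hfa : AnalyticOnNhd ℂ f Set.univ := hf.1.differentiableOn.analyticOnNhd isOpen_univ
  have hga : AnalyticOnNhd ℂ g Set.univ := hg.1.differentiableOn.analyticOnNhd isOpen_univ
  refine hfa.eq_of_frequently_eq (z₀ := 0) hga ?_
  have hlim : Tendsto (fun n : ℕ => ((1 / ((n : ℝ) + 1) : ℝ) : ℂ)) atTop (nhdsWithin 0 {0}ᶜ) := by
    refine tendsto_nhdsWithin_iff.2 ⟨?_, Eventually.of_forall fun n => ?_⟩
    · have := tendsto_one_div_add_atTop_nhds_zero_nat (𝕜 := ℝ)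
      exact (Complex.continuous_ofReal.tendsto' 0 0 Complex.ofReal_zero).comp this
    · have : (1 / ((n : ℝ) + 1) : ℝ) ≠ 0 := by positivity
      rw [Set.mem_compl_singleton_iff]
      exact_mod_cast this
  exact hlim.frequently (Frequently.of_forall fun n => congrFun heq _)

theorem IsFourierLaplace.fourierLaplace_eq {x : 𝓢'(ℝ, ℂ)} {f : ℂ → ℂ} (hf : IsFourierLaplace x f) :
    fourierLaplace x = f := by
  have h : ∃ f, IsFourierLaplace x f := ⟨f, hf⟩
  rw [fourierLaplace, dif_pos h]
  exact h.choose_spec.unique hf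

theorem IsFourierLaplace.add {x y : 𝓢'(ℝ, ℂ)} {f g : ℂ → ℂ} (hf : IsFourierLaplace x f)
    (hg : IsFourierLaplace y g) : IsFourierLaplace (x + y) (fun z => f z + g z) := by
  refine ⟨hf.1.add hg.1, fun φ => ?_⟩
  have h1 : (fun ω : ℝ => (f ω + g ω) * φ ω) = fun ω : ℝ => f ω * φ ω + g ω * φ ω := by
    ext ω; ring
  rw [h1]
  refine ⟨(hf.2 φ).1.add (hg.2 φ).1, ?_⟩
  rw [integral_add (hf.2 φ).1 (hg.2 φ).1, ← (hf.2 φ).2, ← (hg.2 φ).2]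
  rfl

theorem IsFourierLaplace.eq_of_eq {x y : 𝓢'(ℝ, ℂ)} {f : ℂ → ℂ} (hx : IsFourierLaplace x f)
    (hy : IsFourierLaplace y f) : x = y := by
  ext φ
  obtain ⟨ψ, rfl⟩ := angularFourier_surjective φ
  rw [(hx.2 ψ).2, (hy.2 ψ).2]

theorem isFourierLaplace_delta (s : ℝ) :
    IsFourierLaplace (TemperedDistribution.delta s)
      (fun z => Complex.exp (-(Complex.I * s * z))) := by
  refine ⟨by fun_prop, fun φ => ⟨?_, ?_⟩⟩
  · refine φ.integrable.norm.mono' (Continuous.aestronglyMeasurable ?_)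
      (Eventually.of_forall fun t => ?_)
    · have := φ.continuous
      fun_prop
    · rw [norm_mul, Complex.norm_exp]
      simp
  · rw [TemperedDistribution.delta_apply, angularFourier_apply]
    exact integral_congr_ae (Eventually.of_forall fun t => mul_comm _ _)

theorem IsFourierLaplace.const_smul {x : 𝓢'(ℝ, ℂ)} {f : ℂ → ℂ} (hf : IsFourierLaplace x f)
    (c : ℂ) : IsFourierLaplace (c • x) (fun z => c * f z) := by
  refine ⟨hf.1.const_mul c, fun φ => ?_⟩
  simp only [mul_assoc]
  refine ⟨(hf.2 φ).1.const_mul c, ?_⟩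
  rw [integral_const_mul, ← (hf.2 φ).2]
  rfl

/-- A shifted sine is the Fourier–Laplace transform of a combination of two point masses. -/
theorem exists_isFourierLaplace_sin (A τ : ℝ) (w : ℂ) :
    ∃ u : 𝓢'(ℝ, ℂ), IsFourierLaplace u fun z => A * Complex.sin (τ * (z - w)) := by
  have h1 := (isFourierLaplace_delta τ).const_smul
    (A * Complex.I / 2 * Complex.exp (Complex.I * τ * w))
  have h2 := (isFourierLaplace_delta (-τ)).const_smul
    (-(A * Complex.I / 2 * Complex.exp (-(Complex.I * τ * w))))
  obtain ⟨u, hu⟩ : ∃ u, IsFourierLaplace u _ := ⟨_, h1.add h2⟩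
  refine ⟨u, ?_⟩
  convert! hu using 1
  ext z
  have e1 : -((τ : ℂ) * (z - w)) * Complex.I =
      Complex.I * τ * w + -(Complex.I * τ * z) := by ring
  have e2 : (τ : ℂ) * (z - w) * Complex.I =
      -(Complex.I * τ * w) + -(Complex.I * ((-τ : ℝ) : ℂ) * z) := by push_cast; ring
  rw [Complex.sin, e1, e2, Complex.exp_add, Complex.exp_add]
  ring

/-! ### Sine-type functions -/

theorem isSineType_sin {σ : ℝ} (hσ : 0 < σ) {A : ℝ} (hA : 0 < A) (w : ℂ) :
    IsSineType σ fun z => A * Complex.sin (σ * (z - w)) := by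
  have hA' : (A : ℂ) ≠ 0 := by exact_mod_cast hA.ne'
  have hσ' : (σ : ℂ) ≠ 0 := by exact_mod_cast hσ.ne'
  have him : ∀ z : ℂ, |(σ * (z - w) : ℂ).im| = σ * |z.im - w.im| := fun z => by
    rw [Complex.im_ofReal_mul, abs_mul, abs_of_pos hσ, Complex.sub_im]
  have hupper : ∀ z : ℂ, ‖A * Complex.sin (σ * (z - w))‖ ≤
      A * Real.exp (σ * |w.im|) * Real.exp (σ * |z.im|) := by
    intro z
    rw [norm_mul, Complex.norm_real, Real.norm_of_nonneg hA.le, mul_assoc, ← Real.exp_add]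
    gcongr
    refine (norm_sin_le_exp _).trans ?_
    rw [him]
    gcongr
    rw [← mul_add]
    gcongr
    rw [add_comm]
    exact abs_sub _ _
  refine ⟨by fun_prop, ⟨σ, hasExpType_of_norm_le hσ.le hupper⟩, fun z hz => ?_, ?_, ?_⟩
  · have h1 : HasDerivAt (fun z : ℂ => A * Complex.sin (σ * (z - w)))
        (A * (Complex.cos (σ * (z - w)) * σ)) z := by
      simpa using! ((((hasDerivAt_id z).sub_const w).const_mul (σ : ℂ)).csin).const_mul (A : ℂ)
    rw [h1.deriv]
    refine mul_ne_zero hA' (mul_ne_zero (fun hc => ?_) hσ')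
    have h2 : Complex.sin (σ * (z - w)) = 0 := (mul_eq_zero.1 hz).resolve_left hA'
    have h3 := Complex.sin_sq_add_cos_sq (σ * (z - w))
    rw [h2, hc] at h3
    norm_num at h3
  · refine ⟨Real.pi / σ, div_pos Real.pi_pos hσ, fun z v hz hv hzv => ?_⟩
    obtain ⟨k, hk⟩ := Complex.sin_eq_zero_iff.1 ((mul_eq_zero.1 hz).resolve_left hA')
    obtain ⟨l, hl⟩ := Complex.sin_eq_zero_iff.1 ((mul_eq_zero.1 hv).resolve_left hA')
    have h1 : (σ : ℂ) * (z - v) = ((k - l : ℤ) : ℂ) * Real.pi := by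
      push_cast
      linear_combination hk - hl
    have hkl : k - l ≠ 0 := by
      intro h
      rw [h, Int.cast_zero, zero_mul] at h1
      exact hzv (sub_eq_zero.1 ((mul_eq_zero.1 h1).resolve_left hσ'))
    have h2 := congrArg norm h1
    rw [norm_mul, norm_mul, Complex.norm_real, Complex.norm_real, Complex.norm_intCast,
      Real.norm_of_nonneg hσ.le, Real.norm_of_nonneg Real.pi_pos.le] at h2
    have h3 : (1 : ℝ) ≤ |((k - l : ℤ) : ℝ)| := by
      exact_mod_cast Int.one_le_abs hkl
    rw [dist_eq_norm, div_le_iff₀ hσ, mul_comm _ σ, h2]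
    nlinarith [Real.pi_pos]
  · refine ⟨A * (Real.exp (-(σ * |w.im|)) / 4), A * Real.exp (σ * |w.im|), |w.im| + 1 / σ,
      by positivity, by positivity, by positivity, fun z hz => ⟨?_, hupper z⟩⟩
    rw [norm_mul, Complex.norm_real, Real.norm_of_nonneg hA.le, mul_assoc]
    gcongr
    have h1 : |z.im| - |w.im| ≤ |z.im - w.im| := abs_sub_abs_le_abs_sub _ _
    have h2 : 1 ≤ σ * |z.im - w.im| := by
      have : 1 / σ ≤ |z.im - w.im| := by linarith
      rw [div_le_iff₀ hσ] at this
      linarith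
    have h3 := (exp_div_four_le_sinh h2)
    rw [← him z] at h3
    refine le_trans ?_ (h3.trans (sinh_abs_le_norm_sin _))
    rw [div_mul_eq_mul_div, ← Real.exp_add, him]
    gcongr
    nlinarith

/-! ### The tetrahedral frame in `ℂ²` -/

/-- The four vectors of the qubit SIC: their Bloch vectors are the vertices of a regular
tetrahedron. The last three share the modulus of their entries and carry the phases `1, ω, ω²`
with `ω` a primitive third root of unity. -/
def tetrahedralFrame : Fin 4 → EuclideanSpace ℂ (Fin 2) :=
  ![!₂[1, 0],
    !₂[(⟨√3 / 3, 0⟩ : ℂ), ⟨√6 / 3, 0⟩],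
    !₂[(⟨√3 / 3, 0⟩ : ℂ), ⟨-(√6 / 6), √6 * √3 / 6⟩],
    !₂[(⟨√3 / 3, 0⟩ : ℂ), ⟨-(√6 / 6), -(√6 * √3 / 6)⟩]]

theorem sqrt_three_sq : √(3 : ℝ) ^ 2 = 3 := Real.sq_sqrt (by norm_num)

theorem sqrt_six_sq : √(6 : ℝ) ^ 2 = 6 := Real.sq_sqrt (by norm_num)

theorem norm_inner_sq (v w : EuclideanSpace ℂ (Fin 2)) : ‖inner ℂ v w‖ ^ 2 =
    ((v 0).re * (w 0).re + (v 0).im * (w 0).im + (v 1).re * (w 1).re + (v 1).im * (w 1).im) ^ 2 +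
    ((v 0).re * (w 0).im - (v 0).im * (w 0).re + (v 1).re * (w 1).im -
      (v 1).im * (w 1).re) ^ 2 := by
  rw [PiLp.inner_apply, Fin.sum_univ_two, Complex.sq_norm, Complex.normSq_apply]
  simp only [RCLike.inner_apply, Complex.add_re, Complex.add_im, Complex.mul_re, Complex.mul_im,
    Complex.conj_re, Complex.conj_im]
  ring

theorem isTwoUniformTightFrame_tetrahedralFrame :
    IsTwoUniformTightFrame 2 tetrahedralFrame := by
  have h3 := sqrt_three_sq
  have h6 := sqrt_six_sq
  refine ⟨⟨1, fun m => ?_⟩, ⟨√3 / 3, fun i j hij => ?_⟩, fun v => ?_⟩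
  · rw [← sq_eq_sq₀ (norm_nonneg _) zero_le_one, EuclideanSpace.norm_sq_eq, Fin.sum_univ_two]
    fin_cases m <;>
      simp [tetrahedralFrame, Complex.sq_norm, Complex.normSq_apply] <;> grind
  · rw [← sq_eq_sq₀ (norm_nonneg _) (by positivity), norm_inner_sq]
    fin_cases i <;> fin_cases j <;> first | exact absurd rfl hij | skip
    all_goals simp [tetrahedralFrame] <;> grind
  · rw [EuclideanSpace.norm_sq_eq, Fin.sum_univ_two, Fin.sum_univ_four]
    simp only [norm_inner_sq]
    simp [tetrahedralFrame, Complex.sq_norm, Complex.normSq_apply]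
    grind

/-- The four intensities of a vector in `ℂ²` determine the modulus of its first entry and the
relative phase of its two entries. -/
theorem eq_of_intensities {a b a' b' : ℂ}
    (h : ∀ m, ‖tetrahedralFrame m 0 * a + tetrahedralFrame m 1 * b‖ ^ 2 =
      ‖tetrahedralFrame m 0 * a' + tetrahedralFrame m 1 * b'‖ ^ 2) :
    ‖a‖ = ‖a'‖ ∧ b * (starRingEnd ℂ) a = b' * (starRingEnd ℂ) a' := by
  have h3 := sqrt_three_sq
  have h36 : 0 < √(3 : ℝ) * √6 := by positivity
  have e0 := h 0
  have e1 := h 1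
  have e2 := h 2
  have e3 := h 3
  have e : ‖a‖ = ‖a'‖ := by simpa [tetrahedralFrame] using e0
  refine ⟨e, ?_⟩
  simp [tetrahedralFrame, Complex.sq_norm, Complex.normSq_apply] at e1 e2 e3
  set s := √(3 : ℝ)
  set r := √(6 : ℝ)
  -- the cross terms of the three last intensities are `Re (ωᵏ b ā)` up to a common factor
  have hRe : s * r * (b.re * a.re + b.im * a.im) = s * r * (b'.re * a'.re + b'.im * a'.im) := by
    linear_combination (3 / 2) * (2 * e1 - e2 - e3) + (r ^ 2 / 12) *
      (b.re ^ 2 + b.im ^ 2 - b'.re ^ 2 - b'.im ^ 2) * h3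
  have hIm : s * r * (b.im * a.re - b.re * a.im) = s * r * (b'.im * a'.re - b'.re * a'.im) := by
    linear_combination (3 / 2) * s * (e3 - e2) - (s * r / 3) *
      ((b.im * a.re - b.re * a.im) - (b'.im * a'.re - b'.re * a'.im)) * h3
  replace hRe := mul_left_cancel₀ h36.ne' hRe
  replace hIm := mul_left_cancel₀ h36.ne' hIm
  apply Complex.ext
  · simp only [Complex.mul_re, Complex.conj_re, Complex.conj_im]
    linarith
  · simp only [Complex.mul_im, Complex.conj_re, Complex.conj_im]
    linarith

/-! ### Phase propagation and the removal of the common phase -/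

/-- Consecutive blocks share a sample point, so the relative phases of neighbouring samples tie all
samples to a single unknown phase, provided that none of them vanishes. -/
theorem exists_common_phase {a b : ℤ → ℂ} (ha : ∀ n, a n ≠ 0) (hab : ∀ n, ‖a n‖ = ‖b n‖)
    (hstep : ∀ n, a (n + 1) * (starRingEnd ℂ) (a n) = b (n + 1) * (starRingEnd ℂ) (b n)) :
    ∃ γ : ℂ, ∀ n, a n = γ * b n := by
  have hb : ∀ n, b n ≠ 0 := fun n => by
    rw [← norm_pos_iff, ← hab]; exact norm_pos_iff.2 (ha n)
  have hconst : ∀ n, a (n + 1) / b (n + 1) = a n / b n := by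
    intro n
    have h1 : a n * (starRingEnd ℂ) (a n) = b n * (starRingEnd ℂ) (b n) := by
      rw [Complex.mul_conj, Complex.mul_conj, Complex.normSq_eq_norm_sq, Complex.normSq_eq_norm_sq,
        hab]
    have h2 : (starRingEnd ℂ) (b n) ≠ 0 := (map_ne_zero _).2 (hb n)
    have h3 : (starRingEnd ℂ) (a n) ≠ 0 := (map_ne_zero _).2 (ha n)
    rw [div_eq_div_iff (hb _) (hb n)]
    refine mul_right_cancel₀ h3 ?_
    linear_combination b n * hstep n - b (n + 1) * h1
  have hall : ∀ n : ℤ, a n / b n = a 0 / b 0 := by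
    intro n
    induction n using Int.induction_on with
    | zero => rfl
    | succ n ih => rw [hconst, ih]
    | pred n ih => rw [← ih, ← hconst (-n - 1), sub_add_cancel]
  exact ⟨a 0 / b 0, fun n => by rw [← hall n, div_mul_cancel₀ _ (hb n)]⟩

/-- A positive multiple of the faster exponential cannot stay below a multiple of the slower one. -/
theorem nonpos_of_exp_growth {c M a b y₀ : ℝ} (hab : b < a)
    (h : ∀ y, y₀ ≤ y → c * Real.exp (a * y) ≤ M * Real.exp (b * y)) : c ≤ 0 := by
  have hlim : Tendsto (fun y : ℝ => M * Real.exp (-((a - b) * y))) atTop (nhds 0) := by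
    have h1 : Tendsto (fun y : ℝ => (a - b) * y) atTop atTop :=
      tendsto_id.const_mul_atTop (by linarith)
    simpa using! (Real.tendsto_exp_neg_atTop_nhds_zero.comp h1).const_mul M
  refine ge_of_tendsto hlim ?_
  filter_upwards [eventually_ge_atTop y₀] with y hy
  have h2 := h y hy
  have h3 : Real.exp (b * y) = Real.exp (-((a - b) * y)) * Real.exp (a * y) := by
    rw [← Real.exp_add]; ring_nf
  rw [h3, ← mul_assoc] at h2
  exact le_of_mul_le_mul_right h2 (Real.exp_pos _)

/-- A function of type below `π / β` that is bounded on `ℝ` and vanishes on `βℤ` is zero: as a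
multiple of a sine of larger type it would grow too fast. -/
theorem eq_zero_of_vanishing_of_oversampling {f : ℂ → ℂ} {σ β M : ℝ} (hd : Differentiable ℂ f)
    (hβ : 0 < β) (hσ : σ * β < Real.pi) (h : ∀ z, ‖f z‖ ≤ M * Real.exp (σ * |z.im|))
    (h0 : ∀ n : ℤ, f (n * β) = 0) (z : ℂ) : f z = 0 := by
  have hM : 0 ≤ M := by simpa using (norm_nonneg _).trans (h 0)
  have hβ' : (β : ℂ) ≠ 0 := by exact_mod_cast hβ.ne'
  have hg : ∀ z : ℂ, ‖f (z * β)‖ ≤ M * Real.exp (σ * β * |z.im|) := by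
    intro z
    refine (h _).trans (le_of_eq ?_)
    rw [Complex.im_mul_ofReal, abs_mul, abs_of_pos hβ]
    ring_nf
  obtain ⟨c, hc⟩ := eq_const_mul_sin_of_forall_int (f := fun z => f (z * β)) (M := M)
    (hd.comp (by fun_prop)) (fun z => (hg z).trans (by gcongr)) h0
  have hc0 : ‖c‖ / 4 ≤ 0 := by
    refine nonpos_of_exp_growth (M := M) (y₀ := 1) hσ fun y hy => ?_
    have h1 := hg (y * Complex.I)
    have h2 := hc (y * Complex.I)
    rw [h2, norm_mul] at h1
    have h3 := sinh_abs_le_norm_sin (Real.pi * (y * Complex.I))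
    have h4 : |(Real.pi * (y * Complex.I) : ℂ).im| = Real.pi * y := by
      rw [Complex.im_ofReal_mul]
      simp [abs_of_pos Real.pi_pos, abs_of_pos (show 0 < y by linarith)]
    have h5 : |(y * Complex.I : ℂ).im| = y := by simp; linarith
    rw [h4] at h3
    rw [h5] at h1
    have h6 : Real.exp (Real.pi * y) / 4 ≤ Real.sinh (Real.pi * y) :=
      exp_div_four_le_sinh (by nlinarith [Real.pi_gt_three])
    calc ‖c‖ / 4 * Real.exp (Real.pi * y) = ‖c‖ * (Real.exp (Real.pi * y) / 4) := by ring
      _ ≤ ‖c‖ * ‖Complex.sin (Real.pi * (y * Complex.I))‖ := by gcongr; exact h6.trans h3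
      _ ≤ _ := h1
  have hc1 : c = 0 := by
    rw [← norm_le_zero_iff]; linarith
  have h1 := hc (z / β)
  rw [hc1, zero_mul] at h1
  simpa [div_mul_cancel₀ _ hβ'] using h1

/-- The reference function `A sin (τ (z - i))`, whose zeros are off the real line. -/
def reference (A τ : ℝ) (z : ℂ) : ℂ := A * Complex.sin (τ * (z - Complex.I))

theorem le_norm_reference {A τ : ℝ} (hA : 0 ≤ A) (hτ : 0 < τ) (x : ℝ) :
    A * Real.sinh τ ≤ ‖reference A τ x‖ := by
  rw [reference, norm_mul, Complex.norm_real, Real.norm_of_nonneg hA]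
  have h := sinh_abs_le_norm_sin (τ * (x - Complex.I))
  have h1 : |(τ * (x - Complex.I) : ℂ).im| = τ := by
    rw [Complex.im_ofReal_mul]
    simp [abs_of_pos hτ]
  rw [h1] at h
  gcongr

theorem norm_reference_le {A τ : ℝ} (hA : 0 ≤ A) (hτ : 0 < τ) (z : ℂ) :
    ‖reference A τ z‖ ≤ A * Real.exp τ * Real.exp (τ * |z.im|) := by
  rw [reference, norm_mul, Complex.norm_real, Real.norm_of_nonneg hA, mul_assoc, ← Real.exp_add]
  gcongr
  refine (norm_sin_le_exp _).trans ?_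
  rw [Complex.im_ofReal_mul, abs_mul, abs_of_pos hτ, Complex.sub_im, Complex.I_im]
  gcongr
  have h1 : |z.im - 1| ≤ |z.im| + 1 := by
    simpa using abs_sub z.im 1
  nlinarith

theorem differentiable_reference (A τ : ℝ) : Differentiable ℂ (reference A τ) := by
  unfold reference; fun_prop

/-- The reference grows faster along the imaginary axis than functions of type `σ < τ`. -/
theorem eq_zero_of_norm_mul_reference_le {A τ σ M : ℝ} {γ : ℂ} (hA : 0 < A) (hτ : 0 < τ)
    (hσ : σ < τ) (h : ∀ z, ‖γ * reference A τ z‖ ≤ M * Real.exp (σ * |z.im|)) : γ = 0 := by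
  have hc : ‖γ‖ * (A * (Real.exp (-τ) / 4)) ≤ 0 := by
    refine nonpos_of_exp_growth (M := M) (y₀ := 1 + 1 / τ) hσ fun y hy => ?_
    have hτ' : 0 < 1 / τ := by positivity
    have hy0 : 0 < y := by linarith
    have h1 := h (y * Complex.I)
    rw [show |(y * Complex.I : ℂ).im| = y by simp; linarith] at h1
    refine le_trans ?_ h1
    rw [reference, norm_mul, norm_mul, Complex.norm_real, Real.norm_of_nonneg hA.le, mul_assoc,
      mul_assoc]
    gcongr
    have h2 := sinh_abs_le_norm_sin (τ * (y * Complex.I - Complex.I))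
    have h3 : |(τ * (y * Complex.I - Complex.I) : ℂ).im| = τ * (y - 1) := by
      have h6 : (y * Complex.I - Complex.I : ℂ).im = y - 1 := by simp
      rw [Complex.im_ofReal_mul, abs_mul, abs_of_pos hτ, h6, abs_of_nonneg (by linarith)]
    have h5 : 1 / τ ≤ y - 1 := by linarith
    have h4 : 1 ≤ τ * (y - 1) := by
      rw [div_le_iff₀ hτ] at h5
      linarith
    rw [h3] at h2
    refine le_trans (le_of_eq ?_) ((exp_div_four_le_sinh h4).trans h2)
    rw [div_mul_eq_mul_div, ← Real.exp_add]
    ring_nf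
  have h4 : ‖γ‖ ≤ 0 := by
    by_contra! hcon
    have := Real.exp_pos (-τ)
    have : 0 < ‖γ‖ * (A * (Real.exp (-τ) / 4)) := by positivity
    linarith
  exact norm_le_zero_iff.1 h4

/-- At the critical rate and for `p < ∞` the common phase must be trivial: the samples of the
reference stay away from zero, those of a Bernstein function do not. -/
theorem eq_of_samples_of_lt_top {X Y : ℂ → ℂ} {σ τ β A : ℝ} {p : ℝ≥0∞} {γ : ℂ} (hp : 1 ≤ p)
    (hp' : p < ∞) (hσ0 : 0 ≤ σ) (hβ : 0 < β) (hσ : σ * β = Real.pi) (hA : 0 < A) (hτ : 0 < τ)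
    (hX : X ∈ bernsteinSpace σ p) (hY : Y ∈ bernsteinSpace σ p)
    (h : ∀ n : ℤ, X (n * β) + reference A τ (n * β) =
      γ * (Y (n * β) + reference A τ (n * β))) : X = Y := by
  have hW := sub_mem_bernsteinSpace hX (const_mul_mem_bernsteinSpace γ hY)
  have hWn : ∀ n : ℤ, X (n * β) - γ * Y (n * β) = (γ - 1) * reference A τ (n * β) := fun n => by
    linear_combination h n
  have hγ : γ = 1 := by
    by_contra hγ
    refine not_samples_bounded_below hσ0 hp hp'.ne hW hβ (c := ‖γ - 1‖ * (A * Real.sinh τ)) ?_ 0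
      fun n => ?_
    · have h1 := norm_pos_iff.2 (sub_ne_zero.2 hγ)
      have h2 := Real.sinh_pos_iff.2 hτ
      positivity
    · simp only [Complex.ofReal_zero, zero_add]
      rw [hWn, norm_mul]
      gcongr
      have := le_norm_reference hA.le hτ (n * β)
      push_cast at this
      exact this
  ext z
  have h0 := eq_zero_of_vanishing hp hp' hβ hσ hW (fun n => by rw [hWn, hγ]; simp) z
  simpa [hγ, sub_eq_zero] using h0

/-- Above the critical rate the common phase must be trivial because of the larger exponential
type of the reference. -/
theorem eq_of_samples_of_oversampling {X Y : ℂ → ℂ} {σ τ β A : ℝ} {p : ℝ≥0∞} {γ : ℂ} (hp : 1 ≤ p)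
    (hσ0 : 0 ≤ σ) (hβ : 0 < β) (hστ : σ < τ) (hτβ : τ * β < Real.pi) (hA : 0 < A)
    (hX : X ∈ bernsteinSpace σ p) (hY : Y ∈ bernsteinSpace σ p)
    (h : ∀ n : ℤ, X (n * β) + reference A τ (n * β) =
      γ * (Y (n * β) + reference A τ (n * β))) : X = Y := by
  have hτ : 0 < τ := by linarith
  have hW := sub_mem_bernsteinSpace hX (const_mul_mem_bernsteinSpace γ hY)
  have hWb := norm_le_of_mem_bernsteinSpace hσ0 hp hW
  set M := (1 + Real.exp σ) *
    (eLpNorm (fun s : ℝ => X s - γ * Y s) p volume).toReal with hM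
  have hM0 : 0 ≤ M := by positivity
  have hQ : ∀ z, X z - γ * Y z - (γ - 1) * reference A τ z = 0 := by
    refine eq_zero_of_vanishing_of_oversampling (M := M + ‖γ - 1‖ * (A * Real.exp τ))
      (hW.1.sub ((differentiable_reference A τ).const_mul _)) hβ hτβ (fun z => ?_)
      (fun n => by linear_combination h n)
    refine (norm_sub_le _ _).trans ?_
    rw [add_mul]
    refine add_le_add ((hWb z).trans (by gcongr)) ?_
    rw [norm_mul, mul_assoc]
    gcongr
    exact norm_reference_le hA.le hτ z
  have hγ : γ - 1 = 0 := by
    refine eq_zero_of_norm_mul_reference_le (M := M) hA hτ hστ fun z => ?_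
    rw [← sub_eq_zero.1 (hQ z)]
    exact hWb z
  ext z
  have h0 := hQ z
  rw [hγ, sub_eq_zero.1 hγ] at h0
  linear_combination h0

/-! ### The measurement system -/

theorem interpolationSet_pair (β : ℝ) :
    interpolationSet β ![(0 : ℂ), (β : ℂ)] = Set.range fun n : ℤ => (n : ℂ) * β := by
  ext z
  constructor
  · rintro ⟨n, k, rfl⟩
    fin_cases k
    · exact ⟨n, by simp [samplePoint]⟩
    · exact ⟨n + 1, by simp [samplePoint]; ring⟩
  · rintro ⟨n, rfl⟩
    exact ⟨n, 0, by simp [samplePoint]⟩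

/-- With `λ = (0, β)` the overlap condition holds for `a = 1`, and `Λ = βℤ` is complete
interpolating at the critical spacing, or the zero set of a sine at a smaller one. -/
theorem conditionB_pair {T β : ℝ} {p : ℝ≥0∞} (hβ : 0 < β)
    (h1 : 1 < p → p < ∞ → T / 2 * β = Real.pi)
    (h2 : p = 1 ∨ p = ∞ → ∃ T₁ > T, 0 < T₁ ∧ T₁ / 2 * β = Real.pi) :
    ConditionB T p β ![(0 : ℂ), (β : ℂ)] := by
  have hβ' : (β : ℂ) ≠ 0 := by exact_mod_cast hβ.ne'
  refine ⟨hβ, ?_, ?_, ⟨1, le_rfl, one_lt_two, ?_⟩, ?_, ?_⟩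
  · intro i j hij
    fin_cases i <;> fin_cases j <;> simp_all
    exact hβ' (by exact_mod_cast hij.symm)
  · intro i j hij
    fin_cases i <;> fin_cases j <;> simp_all [hβ.le]
  · intro n i j hi hj
    fin_cases i <;> fin_cases j <;> simp_all [samplePoint]
    ring
  · intro hp hp'
    rw [interpolationSet_pair]
    exact isCompleteInterpolating_range hp hp' hβ (h1 hp hp')
  · intro hp
    obtain ⟨T₁, hT₁, hT₁0, hT₁β⟩ := h2 hp
    have hσ : (0 : ℝ) < T₁ / 2 := by positivity
    have hσ' : ((T₁ / 2 : ℝ) : ℂ) ≠ 0 := by exact_mod_cast hσ.ne'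
    have hβσ : ((T₁ / 2 : ℝ) : ℂ) * β = Real.pi := by exact_mod_cast hT₁β
    refine ⟨T₁, hT₁, _, isSineType_sin hσ one_pos 0, ?_⟩
    rw [interpolationSet_pair]
    ext z
    simp only [Set.mem_range, Set.mem_ofPred_eq, Complex.ofReal_one, one_mul, sub_zero,
      Complex.sin_eq_zero_iff, ← hβσ]
    refine exists_congr fun n => ⟨fun h => ?_, fun h => ?_⟩
    · rw [← h]; ring
    · refine mul_left_cancel₀ hσ' ?_
      rw [h]; ring

theorem conditionA_tetrahedralFrame : ConditionA (K := 2) tetrahedralFrame := by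
  have h := isTwoUniformTightFrame_tetrahedralFrame
  unfold ConditionA
  norm_num
  exact h

/-- Equal intensities force the samples of `x̂ + û` and `ŷ + û` to agree up to a common phase. -/
theorem exists_phase_of_intensity_eq {x y u : 𝓢'(ℝ, ℂ)} {X Y : ℂ → ℂ} {A τ β : ℝ}
    (hx : IsFourierLaplace x X) (hy : IsFourierLaplace y Y)
    (hu : IsFourierLaplace u (reference A τ))
    (h0 : ∀ n : ℤ, X (n * β) + reference A τ (n * β) ≠ 0)
    (h : ∀ (n : ℤ) (m : Fin (2 ^ 2)),
      intensity u (tetrahedralFrame : Fin (2 ^ 2) → EuclideanSpace ℂ (Fin 2)) β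
        ![(0 : ℂ), (β : ℂ)] x n m =
      intensity u (tetrahedralFrame : Fin (2 ^ 2) → EuclideanSpace ℂ (Fin 2)) β
        ![(0 : ℂ), (β : ℂ)] y n m) :
    ∃ γ : ℂ, ∀ n : ℤ, X (n * β) + reference A τ (n * β) =
      γ * (Y (n * β) + reference A τ (n * β)) := by
  have hpair : ∀ n : ℤ, _ := fun n => eq_of_intensities
    (a := X (n * β) + reference A τ (n * β))
    (b := X ((n + 1 : ℤ) * β) + reference A τ ((n + 1 : ℤ) * β))
    (a' := Y (n * β) + reference A τ (n * β))
    (b' := Y ((n + 1 : ℤ) * β) + reference A τ ((n + 1 : ℤ) * β)) fun m => by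
      have h1 := h n m
      simp only [intensity, (hx.add hu).fourierLaplace_eq, (hy.add hu).fourierLaplace_eq,
        Fin.sum_univ_two, samplePoint] at h1
      have e : ((n + 1 : ℤ) : ℂ) * β = n * β + β := by push_cast; ring
      rw [e]
      simpa using! h1
  exact exists_common_phase (a := fun n : ℤ => X (n * β) + reference A τ (n * β))
    (b := fun n : ℤ => Y (n * β) + reference A τ (n * β)) h0 (fun n => (hpair n).1)
    (fun n => (hpair n).2)

end PhaseRetrieval

end

theorem mainTheorem2 (T : ℝ) (hT : 0 < T) (p : ℝ≥0∞) (hp : 1 ≤ p) (ε : ℝ) (hε : 0 < ε) :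
    ∃ (u : 𝓢'(ℝ, ℂ)) (K : ℕ) (α : Fin (K ^ 2) → EuclideanSpace ℂ (Fin K)) (lam : Fin K → ℂ)
      (β : ℝ),
      (∃ T' > T, PhaseRetrieval.IsSineType (T' / 2) (PhaseRetrieval.fourierLaplace u)) ∧
      PhaseRetrieval.ConditionA α ∧
      PhaseRetrieval.ConditionB T p β lam ∧
      |PhaseRetrieval.samplingRate K β - 4 * PhaseRetrieval.nyquistRate T| < ε ∧
      ∀ x ∈ PhaseRetrieval.signalSpace T p, PhaseRetrieval.signalNorm p x ≤ 1 →
        ∀ y ∈ PhaseRetrieval.signalSpace T p, PhaseRetrieval.signalNorm p y ≤ 1 →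
          (∀ (n : ℤ) (m : Fin (K ^ 2)),
            PhaseRetrieval.intensity u α β lam x n m = PhaseRetrieval.intensity u α β lam y n m) →
          ∃ θ : ℝ, y = Complex.exp (Complex.I * θ) • x := by
  have hpi := Real.pi_gt_three
  have hpi0 := Real.pi_pos
  set τ : ℝ := (T + ε / 2) / 2 with hτ
  have hτ0 : 0 < τ := by positivity
  have hsinh : 0 < Real.sinh τ := Real.sinh_pos_iff.2 hτ0
  -- every signal of norm at most one is bounded on `ℝ` by `1 + exp (T / 2)`, which the reference
  -- exceeds everywhere on `ℝ`
  set A : ℝ := (2 + Real.exp (T / 2)) / Real.sinh τ with hA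
  have hA0 : 0 < A := by positivity
  obtain ⟨u, hu⟩ := PhaseRetrieval.exists_isFourierLaplace_sin A τ Complex.I
  -- sampling at the critical rate where `ℓ^p` interpolation is available, slightly above otherwise
  obtain ⟨β, hβ, hB1, hB2, hrate, huniq⟩ : ∃ β : ℝ, 0 < β ∧
      (1 < p → p < ∞ → T / 2 * β = Real.pi) ∧
      (p = 1 ∨ p = ∞ → ∃ T₁ > T, 0 < T₁ ∧ T₁ / 2 * β = Real.pi) ∧
      |PhaseRetrieval.samplingRate 2 β - 4 * PhaseRetrieval.nyquistRate T| < ε ∧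
      ∀ (X Y : ℂ → ℂ) (γ : ℂ), X ∈ PhaseRetrieval.bernsteinSpace (T / 2) p →
        Y ∈ PhaseRetrieval.bernsteinSpace (T / 2) p →
        (∀ n : ℤ, X (n * β) + PhaseRetrieval.reference A τ (n * β) =
          γ * (Y (n * β) + PhaseRetrieval.reference A τ (n * β))) → X = Y := by
    by_cases hcase : 1 < p ∧ p < ∞
    · have hβ : T / 2 * (2 * Real.pi / T) = Real.pi := by field_simp
      refine ⟨2 * Real.pi / T, by positivity, fun _ _ => hβ, ?_, ?_, fun X Y γ hX hY h => ?_⟩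
      · rintro (h | h)
        · exact absurd h hcase.1.ne'
        · exact absurd h hcase.2.ne
      · have : PhaseRetrieval.samplingRate 2 (2 * Real.pi / T) -
            4 * PhaseRetrieval.nyquistRate T = 0 := by
          rw [PhaseRetrieval.samplingRate, PhaseRetrieval.nyquistRate]
          push_cast
          field_simp
          norm_num
        rw [this, abs_zero]
        exact hε
      · exact PhaseRetrieval.eq_of_samples_of_lt_top hp hcase.2 (by positivity) (by positivity) hβ
          hA0 hτ0 hX hY h
    · have hβ : (T + ε) / 2 * (2 * Real.pi / (T + ε)) = Real.pi := by field_simp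
      refine ⟨2 * Real.pi / (T + ε), by positivity, fun h1 h2 => absurd ⟨h1, h2⟩ hcase,
        fun _ => ⟨T + ε, by linarith, by positivity, hβ⟩, ?_, fun X Y γ hX hY h => ?_⟩
      · have : PhaseRetrieval.samplingRate 2 (2 * Real.pi / (T + ε)) -
            4 * PhaseRetrieval.nyquistRate T = 2 * ε / Real.pi := by
          rw [PhaseRetrieval.samplingRate, PhaseRetrieval.nyquistRate]
          push_cast
          field_simp
          ring
        rw [this, abs_of_pos (by positivity), div_lt_iff₀ hpi0]
        nlinarith
      · refine PhaseRetrieval.eq_of_samples_of_oversampling hp (by positivity) (by positivity)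
          (by linarith) ?_ hA0 hX hY h
        calc τ * (2 * Real.pi / (T + ε)) < (T + ε) / 2 * (2 * Real.pi / (T + ε)) := by
              gcongr
              linarith
          _ = Real.pi := hβ
  refine ⟨u, 2, PhaseRetrieval.tetrahedralFrame, ![(0 : ℂ), (β : ℂ)], β,
    ⟨T + ε / 2, by linarith, ?_⟩, PhaseRetrieval.conditionA_tetrahedralFrame,
    PhaseRetrieval.conditionB_pair hβ hB1 hB2, hrate, ?_⟩
  · rw [hu.fourierLaplace_eq]
    exact PhaseRetrieval.isSineType_sin hτ0 hA0 Complex.I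
  · rintro x ⟨X, hX, hxX⟩ hx1 y ⟨Y, hY, hyY⟩ hy1 h
    have hX0 : ∀ n : ℤ, X (n * β) + PhaseRetrieval.reference A τ (n * β) ≠ 0 := by
      intro n h0
      have h1 := PhaseRetrieval.norm_le_of_mem_bernsteinSpace (by positivity) hp hX (n * β)
      have h2 := PhaseRetrieval.le_norm_reference hA0.le hτ0 (n * β)
      rw [PhaseRetrieval.signalNorm, hxX.fourierLaplace_eq] at hx1
      have h3 : (eLpNorm (fun s : ℝ => X s) p volume).toReal ≤ 1 :=
        ENNReal.toReal_le_of_le_ofReal zero_le_one (by simpa using hx1)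
      have h4 : ((n : ℂ) * β).im = 0 := by simp
      rw [h4, abs_zero, mul_zero, Real.exp_zero, mul_one, eq_neg_of_add_eq_zero_left h0,
        norm_neg] at h1
      rw [hA, div_mul_cancel₀ _ hsinh.ne'] at h2
      push_cast at h2
      have h5 := Real.exp_pos (T / 2)
      nlinarith
    obtain ⟨γ, hγ⟩ := PhaseRetrieval.exists_phase_of_intensity_eq hxX hyY hu hX0 h
    obtain rfl := huniq X Y γ hX hY hγ
    exact ⟨0, by simpa using hyY.eq_of_eq hxX⟩
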